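/- Let $\mathbb K$ be an algebraically closed field of characteristic $0$ and $I=\{1,\dots,r\}$. Let $A=(A_{ij})_{i,j\in I}$ be an invertible generalised Cartan matrix, let $\epsilon_i\in\mathbb K\setminus\{0\}$ be such that $\mathrm{diag}(\epsilon_i)^{-1}A$ is symmetric, and let $\mathfrak g$ be the Kac–Moody algebra of $A$ with Chevalley generators $e_i,f_i,h_i$, $[h_i,e_j]=A_{ij}e_j$, with the invariant symmetric bilinear form $\kappa$ such that $\kappa(e_i,f_j)=\delta_{ij}\epsilon_j$. Let $\lambda_i\in\mathbb Z_{\ge0}$ ($i\in I$) be the Dynkin labels of a dominant integral weight, $J=\{j\in I:\lambda_j\ne0\}$ and $K=\{k\in I:\lambda_k=0\}$. Define $B=(B_{ij})_{i,j\in\{0\}\cup I}$ by $B_{00}=0$, $B_{i0}=-\lambda_i$, $B_{0j}=-\lambda_j/\epsilon_j$, $B_{ij}=A_{ij}$, and assume that $B$ and $(A_{kl})_{k,l\in K}$ are invertible. Let $\tilde W$ be the Lie superalgebra over $\mathbb K$ with odd generators $e_0$ and $f_{0i}$ ($i\in\{0\}\cup K$), even generators $e_i,f_i$ ($i\in I$)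 and $h_i$ ($i\in\{0\}\cup I$), and relations (for all indices for which the generators are defined) $$[e_i,f_j]=\delta_{ij}h_j,\quad [h_i,f_j]=-B_{ij}f_j,\quad [h_i,e_j]=B_{ij}e_j,\quad [e_0,f_{0i}]=h_i,\quad [h_i,f_{0j}]=-B_{i0}f_{0j},$$ $$(\mathrm{ad}\,e_i)^{1-B_{ij}}(e_j)=0,\qquad (\mathrm{ad}\,f_i)^{1-B_{ij}}(f_j)=0\qquad\text{whenever } -B_{ij}\in\mathbb Z_{\ge0},$$ and, for $k,l\in K$, $j\in J$, $i\in\{0\}\cup K$, $$[e_k,[f_l,f_{0i}]]=\delta_{kl}B_{il}f_{0k},\quad (\mathrm{ad}\,f_j)^{1-B_{j0}}(f_{0i})=[e_j,f_{0i}]=0,$$ $$[e_k,[e_k,f_{0i}]]=[f_k,[f_k,f_{0i}]]=0,\quad [e_j,[e_k,f_{0i}]]=0.$$ Give $\tilde W$ the $\mathbb Z$-grading with $e_0$ in degree $1$, the $f_{0i}$ in degree $-1$ and the other generators in degree $0$, and let $W$ be the quotient of $\tilde W$ by its maximal graded ideal intersecting $\tilde W_{-1}\oplus\tilde W_0\oplus\tilde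 W_1$ trivially. There is a canonical homomorphism $\mathfrak g\to W_0$ sending generators to the generators of the same name; through it $\mathfrak g$ acts on $W$, and for $x\in\mathfrak g$, $w\in W$ we write $[x,w]$ for this action. Let $\mathfrak g^-\subseteq\mathfrak g$ be the subalgebra generated by $e_k,f_k,h_k$ for $k\in K$, and $\mathfrak h^-$ the span of the $h_k$, $k\in K$. A weight of $\mathfrak g^-$ is an element of $(\mathfrak h^-)^*$. Let $\varphi:\mathfrak h^-\to(\mathfrak h^-)^*$ be the isomorphism $\varphi(h)(h')=\kappa(h,h')$, and set $(\mu,\nu)=\kappa(\varphi^{-1}(\mu),\varphi^{-1}(\nu))$. With $\alpha_k$ the simple roots, the elements $\alpha_k{}^\vee=\epsilon_k\alpha_k=\varphi(h_k)$, $k\in K$, form a basis of $(\mathfrak h^-)^*$; for $\mu=\sum_{k\in K}c_k\alpha_k{}^\vee$ set $f_{0\mu^\vee}=\sum_{k\in K}c_kf_{0k}$. **Proposition.** Suppose that $\mathfrak g^-$ is finite-dimensional. Then there is exactly one linear map $\sharp:\mathfrak g^-\to W$, $x\mapsto x^\sharp$, such that $$e_\alpha{}^\sharp=\frac1{(\mu,\alpha)}[e_\alpha,f_{0\mu^\vee}],\qquad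 h_k{}^\sharp=-f_{0k}\quad(k\in K),$$ for every root $\alpha$ of $\mathfrak g^-$, every root vector $e_\alpha$ for $\alpha$ and every weight $\mu$ of $\mathfrak g^-$ with $(\mu,\alpha)\neq0$. It takes values in $W_{-1}$, and it is $\mathfrak g^-$-equivariant: $$[x,y^\sharp]=[x,y]^\sharp\qquad\text{for all }x,y\in\mathfrak g^-.$$ Its image is the $\mathfrak g^-$-submodule of $W$ generated by the elements $f_{0k}$, $k\in K$, and its kernel is the kernel of the canonical map $\mathfrak g^-\to W$. Hence the $\mathfrak g^-$-module generated by the $f_{0k}$ is isomorphic to the image of $\mathfrak g^-$ in $W$ with the adjoint action; in particular, if $\mathfrak g^-\to W$ is injective (so that $\mathfrak g^-$ is a subalgebra of $W$), then $\sharp$ is an isomorphism from the adjoint module of $\mathfrak g^-$ onto this module. -/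

import Mathlib

open scoped BigOperators

noncomputable section

namespace THA

universe u

/-! ## Ideals and quotients of algebras given by a bilinear bracket -/

section General

variable {𝕂 M : Type u} [Field 𝕂] [AddCommGroup M] [Module 𝕂 M]

/-- A subspace `I` is a (two-sided) ideal with respect to the bilinear bracket `β`. -/
def IsIdealFor (β : M →ₗ[𝕂] M →ₗ[𝕂] M) (I : Submodule 𝕂 M) : Prop :=
  ∀ x, ∀ y ∈ I, β x y ∈ I ∧ β y x ∈ I

/-- The ideal generated by a set. -/
def idealClosure (β : M →ₗ[𝕂] M →ₗ[𝕂] M) (S : Set M) : Submodule 𝕂 M :=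
  sInf {I | IsIdealFor β I ∧ S ⊆ I}

theorem isIdealFor_idealClosure (β : M →ₗ[𝕂] M →ₗ[𝕂] M) (S : Set M) :
    IsIdealFor β (idealClosure β S) := by
  intro x y hy
  simp only [idealClosure, Submodule.mem_sInf] at hy ⊢
  exact ⟨fun I hI => (hI.1 x y (hy I hI)).1, fun I hI => (hI.1 x y (hy I hI)).2⟩

theorem subset_idealClosure (β : M →ₗ[𝕂] M →ₗ[𝕂] M) (S : Set M) :
    S ⊆ idealClosure β S := by
  intro x hx
  simp only [idealClosure, SetLike.mem_coe, Submodule.mem_sInf]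
  exact fun I hI => hI.2 hx

theorem isIdealFor_sSup (β : M →ₗ[𝕂] M →ₗ[𝕂] M) (T : Set (Submodule 𝕂 M))
    (hT : ∀ I ∈ T, IsIdealFor β I) : IsIdealFor β (sSup T) := by
  intro x
  suffices h : sSup T ≤ (sSup T).comap (β x) ⊓ (sSup T).comap (β.flip x) from
    fun y hy => ⟨(h hy).1, (h hy).2⟩
  refine sSup_le fun I hI y hy => ⟨?_, ?_⟩
  · exact (le_sSup hI : I ≤ sSup T) (hT I hI x y hy).1
  · exact (le_sSup hI : I ≤ sSup T) (hT I hI x y hy).2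

/-- The bracket induced on the quotient by an ideal. -/
def quotBracket (β : M →ₗ[𝕂] M →ₗ[𝕂] M) (I : Submodule 𝕂 M) (hI : IsIdealFor β I) :
    (M ⧸ I) →ₗ[𝕂] (M ⧸ I) →ₗ[𝕂] (M ⧸ I) :=
  I.liftQ
    { toFun := fun x => I.mapQ I (β x) (fun y hy => (hI x y hy).1)
      map_add' := by
        intro x y
        ext z
        simp
      map_smul' := by
        intro c x
        ext z
        simp }
    (by
      intro x hx
      rw [LinearMap.mem_ker]
      ext z
      simpa using (hI z x hx).2)

@[simp]
theorem quotBracket_mk (β : M →ₗ[𝕂] M →ₗ[𝕂] M) (I : Submodule 𝕂 M) (hI : IsIdealFor β I)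
    (x y : M) : quotBracket β I hI (I.mkQ x) (I.mkQ y) = I.mkQ (β x y) := rfl

end General

/-! ## The free nonassociative algebra on a set of generators with integer degrees -/

section Free

variable (𝕂 : Type u) [Field 𝕂] {X : Type u} (d : X → ℤ)

/-- The degree of a nonassociative monomial. -/
def monDegree : FreeMagma X → ℤ
  | FreeMagma.of x => d x
  | FreeMagma.mul a b => monDegree a + monDegree b

/-- The span of the monomials of degree `n`. -/
def freeGrade (n : ℤ) : Submodule 𝕂 (FreeNonUnitalNonAssocAlgebra 𝕂 X) :=
  Submodule.span 𝕂 {z | ∃ m : FreeMagma X, monDegree d m = n ∧ z = MonoidAlgebra.ofMagma 𝕂 _ m}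

theorem of_mem_freeGrade (x : X) :
    FreeNonUnitalNonAssocAlgebra.of 𝕂 x ∈ freeGrade 𝕂 d (d x) :=
  Submodule.subset_span ⟨FreeMagma.of x, rfl, rfl⟩

theorem mul_mem_freeGrade {m n : ℤ} {x y : FreeNonUnitalNonAssocAlgebra 𝕂 X}
    (hx : x ∈ freeGrade 𝕂 d m) (hy : y ∈ freeGrade 𝕂 d n) : x * y ∈ freeGrade 𝕂 d (m + n) := by
  induction hx using Submodule.span_induction with
  | zero => simp
  | add a b _ _ ha hb => rw [add_mul]; exact add_mem ha hb
  | smul c a _ ha => rw [smul_mul_assoc]; exact Submodule.smul_mem _ _ ha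
  | mem a ha =>
    obtain ⟨p, rfl, rfl⟩ := ha
    induction hy using Submodule.span_induction with
    | zero => simp
    | add a b _ _ ha hb => rw [mul_add]; exact add_mem ha hb
    | smul c a _ ha => rw [mul_smul_comm]; exact Submodule.smul_mem _ _ ha
    | mem b hb =>
      obtain ⟨q, rfl, rfl⟩ := hb
      rw [← map_mul]
      exact Submodule.subset_span ⟨p * q, rfl, rfl⟩

/-- The elements which have to vanish for the product to be a Lie superbracket, the parity of an
element of degree `n` being `n` modulo `2`: graded skew-symmetry
`[x, y] = -(-1)^(mn) [y, x]` and the graded Jacobi identity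
`[x, [y, z]] = [[x, y], z] + (-1)^(mn) [y, [x, z]]`, for `x` of degree `m` and `y` of degree `n`. -/
def superRelations : Set (FreeNonUnitalNonAssocAlgebra 𝕂 X) :=
  {w | ∃ m n : ℤ, ∃ x ∈ freeGrade 𝕂 d m, ∃ y ∈ freeGrade 𝕂 d n,
      w = x * y + (m * n).negOnePow • (y * x)} ∪
  {w | ∃ m n : ℤ, ∃ x ∈ freeGrade 𝕂 d m, ∃ y ∈ freeGrade 𝕂 d n, ∃ z,
      w = x * (y * z) - (x * y) * z - (m * n).negOnePow • (y * (x * z))}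

end Free

/-! ## The Kac–Moody algebra and the data -/

section Serre

variable (𝕂 : Type u) [Field 𝕂] {ι : Type} [DecidableEq ι] (A : Matrix ι ι ℤ)

/-- The Chevalley generator `e_i` of the Lie algebra with Cartan matrix `A`. -/
def gE (i : ι) : Matrix.ToLieAlgebra 𝕂 A :=
  LieSubmodule.Quotient.mk (N := CartanMatrix.Relations.toIdeal 𝕂 A)
    (FreeLieAlgebra.of 𝕂 (CartanMatrix.Generators.E i))

/-- The Chevalley generator `f_i`. -/
def gF (i : ι) : Matrix.ToLieAlgebra 𝕂 A :=
  LieSubmodule.Quotient.mk (N := CartanMatrix.Relations.toIdeal 𝕂 A)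
    (FreeLieAlgebra.of 𝕂 (CartanMatrix.Generators.F i))

/-- The Cartan element `h_i`. -/
def gH (i : ι) : Matrix.ToLieAlgebra 𝕂 A :=
  LieSubmodule.Quotient.mk (N := CartanMatrix.Relations.toIdeal 𝕂 A)
    (FreeLieAlgebra.of 𝕂 (CartanMatrix.Generators.H i))

theorem g_rel {x : FreeLieAlgebra 𝕂 (CartanMatrix.Generators ι)}
    (hx : x ∈ CartanMatrix.Relations.toSet 𝕂 A) :
    (LieSubmodule.Quotient.mk (N := CartanMatrix.Relations.toIdeal 𝕂 A) x :
      FreeLieAlgebra 𝕂 (CartanMatrix.Generators ι) ⧸ CartanMatrix.Relations.toIdeal 𝕂 A) = 0 :=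
  LieSubmodule.Quotient.mk_eq_zero'.2 (LieSubmodule.subset_lieSpan hx)

theorem g_ef (i : ι) : ⁅gE 𝕂 A i, gF 𝕂 A i⁆ = gH 𝕂 A i := by
  have h := g_rel 𝕂 A (x := CartanMatrix.Relations.EF 𝕂 (i, i))
    (by simp [CartanMatrix.Relations.toSet])
  simp only [CartanMatrix.Relations.EF, Function.uncurry, if_true, Function.comp] at h
  exact sub_eq_zero.1 h

theorem g_hf (i j : ι) : ⁅gH 𝕂 A i, gF 𝕂 A j⁆ = -((A i j : 𝕂) • gF 𝕂 A j) := by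
  have h := g_rel 𝕂 A (x := CartanMatrix.Relations.HF 𝕂 A (i, j))
    (by simp [CartanMatrix.Relations.toSet])
  simp only [CartanMatrix.Relations.HF, Function.uncurry, Function.comp] at h
  rw [← Int.cast_smul_eq_zsmul 𝕂] at h
  exact eq_neg_of_add_eq_zero_left h

end Serre

/-- The matrix `B`, obtained from `A` by adding the row and the column `0` (here `none`):
`B_00 = 0`, `B_i0 = -λ_i`, `B_0j = -λ_j / ε_j`, `B_ij = A_ij`. -/
def extendedCartan {𝕂 : Type u} [Field 𝕂] {r : ℕ} (A : Matrix (Fin r) (Fin r) ℤ)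
    (lam : Fin r → ℕ) (ε : Fin r → 𝕂) : Matrix (Option (Fin r)) (Option (Fin r)) 𝕂
  | none, none => 0
  | some i, none => -(lam i : 𝕂)
  | none, some j => -((ε j)⁻¹ * (lam j : 𝕂))
  | some i, some j => (A i j : 𝕂)

/-- The data `(𝔤, λ, κ)`: a symmetrisable invertible generalised Cartan matrix `A` with its
Kac–Moody algebra `𝔤` (in Chevalley–Serre presentation), a dominant integral weight `λ` with Dynkin
labels `lam i`, and the invariant symmetric bilinear form `κ` with `κ(e_i, f_j) = δ_ij ε_j`; the
matrix `B` and the Cartan matrix of `𝔤⁻` are invertible. -/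
structure Datum (𝕂 : Type u) [Field 𝕂] (r : ℕ) where
  A : Matrix (Fin r) (Fin r) ℤ
  A_diag : ∀ i, A i i = 2
  A_offdiag : ∀ i j, i ≠ j → A i j ≤ 0
  A_zero : ∀ i j, A i j = 0 → A j i = 0
  A_det : A.det ≠ 0
  lam : Fin r → ℕ
  ε : Fin r → 𝕂
  ε_ne : ∀ i, ε i ≠ 0
  ε_symm : ∀ i j, (ε i)⁻¹ * (A i j : 𝕂) = (ε j)⁻¹ * (A j i : 𝕂)
  κ : LinearMap.BilinForm 𝕂 (Matrix.ToLieAlgebra 𝕂 A)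
  κ_symm : ∀ x y, κ x y = κ y x
  κ_inv : ∀ x y z, κ ⁅x, y⁆ z = κ x ⁅y, z⁆
  κ_ef : ∀ i j, κ (gE 𝕂 A i) (gF 𝕂 A j) = if i = j then ε j else 0
  B_det : (extendedCartan A lam ε).det ≠ 0
  AK_det : (A.submatrix (Subtype.val : {k // lam k = 0} → Fin r) Subtype.val).det ≠ 0

namespace Datum

variable {𝕂 : Type u} [Field 𝕂] {r : ℕ} (D : Datum 𝕂 r)

/-- The Kac–Moody algebra `𝔤`. -/
abbrev g : Type u := Matrix.ToLieAlgebra 𝕂 D.A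

/-- The matrix `B`. -/
abbrev B : Matrix (Option (Fin r)) (Option (Fin r)) 𝕂 := extendedCartan D.A D.lam D.ε

/-- The index set `K` of the nodes with `λ_k = 0`. -/
abbrev K : Type := {k : Fin r // D.lam k = 0}

/-- The inclusion of `{0} ∪ K` into `{0} ∪ I`. -/
abbrev inc : Option D.K → Option (Fin r) := Option.map Subtype.val

end Datum

/-! ## The tensor hierarchy algebra -/

/-- The generators of the tensor hierarchy algebra: `e_i` and `h_i` for `i ∈ {0} ∪ I`, `f_i` for
`i ∈ I`, and `f_{0i}` for `i ∈ {0} ∪ K`. -/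
inductive Gen {𝕂 : Type u} [Field 𝕂] {r : ℕ} (D : Datum 𝕂 r) : Type u
  | e : Option (Fin r) → Gen D
  | f : Fin r → Gen D
  | h : Option (Fin r) → Gen D
  | f0 : Option D.K → Gen D

namespace Datum

variable {𝕂 : Type u} [Field 𝕂] {r : ℕ} (D : Datum 𝕂 r)

/-- The consistent degree: `e_0` has degree `1`, the `f_{0i}` have degree `-1`, all other generators
have degree `0`. -/
def genDegree : Gen D → ℤ
  | Gen.e none => 1
  | Gen.e (some _) => 0
  | Gen.f _ => 0
  | Gen.h _ => 0
  | Gen.f0 _ => -1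

/-- The free nonassociative algebra on the generators. -/
abbrev FreeAlg : Type u := FreeNonUnitalNonAssocAlgebra 𝕂 (Gen D)

/-- The generators as elements of the free nonassociative algebra. -/
abbrev fe (i : Option (Fin r)) : D.FreeAlg := FreeNonUnitalNonAssocAlgebra.of 𝕂 (Gen.e i)
/-- A generator as an element of the free nonassociative algebra. -/
abbrev ff (i : Fin r) : D.FreeAlg := FreeNonUnitalNonAssocAlgebra.of 𝕂 (Gen.f i)
/-- A generator as an element of the free nonassociative algebra. -/
abbrev fh (i : Option (Fin r)) : D.FreeAlg := FreeNonUnitalNonAssocAlgebra.of 𝕂 (Gen.h i)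
/-- A generator as an element of the free nonassociative algebra. -/
abbrev ff0 (i : Option D.K) : D.FreeAlg := FreeNonUnitalNonAssocAlgebra.of 𝕂 (Gen.f0 i)

/-- `(ad x)^n y` in the free nonassociative algebra. -/
abbrev adPow (x : D.FreeAlg) (n : ℕ) (y : D.FreeAlg) : D.FreeAlg := (fun z => x * z)^[n] y

/-- The defining relations, as elements that are set to zero. The Serre exponent `1 - B_ij` is
written as `n + 1` where `B_ij = -n` with a natural number `n`. -/
inductive Rel : D.FreeAlg → Prop
  | ef (i : Option (Fin r)) (j : Fin r) :
      Rel (D.fe i * D.ff j - if i = some j then D.fh (some j) else 0)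
  | hf (i : Option (Fin r)) (j : Fin r) :
      Rel (D.fh i * D.ff j + D.B i (some j) • D.ff j)
  | he (i j : Option (Fin r)) :
      Rel (D.fh i * D.fe j - D.B i j • D.fe j)
  | e0f0 (i : Option D.K) :
      Rel (D.fe none * D.ff0 i - D.fh (D.inc i))
  | hf0 (i : Option (Fin r)) (j : Option D.K) :
      Rel (D.fh i * D.ff0 j + D.B i none • D.ff0 j)
  | serreE (i j : Option (Fin r)) (n : ℕ) (hn : D.B i j = -(n : 𝕂)) :
      Rel (D.adPow (D.fe i) (n + 1) (D.fe j))
  | serreF (i j : Fin r) (n : ℕ) (hn : D.B (some i) (some j) = -(n : 𝕂)) :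
      Rel (D.adPow (D.ff i) (n + 1) (D.ff j))
  | ekfl (k l : D.K) (i : Option D.K) :
      Rel (D.fe (some k) * (D.ff l * D.ff0 i) -
        if k = l then D.B (D.inc i) (some l) • D.ff0 (some k) else 0)
  | fj (j : Fin r) (hj : D.lam j ≠ 0) (i : Option D.K) (n : ℕ)
      (hn : D.B (some j) none = -(n : 𝕂)) :
      Rel (D.adPow (D.ff j) (n + 1) (D.ff0 i))
  | ej (j : Fin r) (hj : D.lam j ≠ 0) (i : Option D.K) :
      Rel (D.fe (some j) * D.ff0 i)
  | ekek (k : D.K) (i : Option D.K) :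
      Rel (D.fe (some k) * (D.fe (some k) * D.ff0 i))
  | fkfk (k : D.K) (i : Option D.K) :
      Rel (D.ff k * (D.ff k * D.ff0 i))
  | ejek (j : Fin r) (hj : D.lam j ≠ 0) (k : D.K) (i : Option D.K) :
      Rel (D.fe (some j) * (D.fe (some k) * D.ff0 i))

/-- The ideal of the free nonassociative algebra generated by the Lie superalgebra identities and
the defining relations. -/
def relIdeal : Submodule 𝕂 D.FreeAlg :=
  idealClosure (LinearMap.mul 𝕂 D.FreeAlg)
    (superRelations 𝕂 D.genDegree ∪ {w | D.Rel w})

/-- The Lie superalgebra `W̃` given by generators and relations. -/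
abbrev WTilde : Type u := D.FreeAlg ⧸ D.relIdeal

/-- The bracket of `W̃`. -/
def tildeBracket : D.WTilde →ₗ[𝕂] D.WTilde →ₗ[𝕂] D.WTilde :=
  quotBracket (LinearMap.mul 𝕂 D.FreeAlg) D.relIdeal (isIdealFor_idealClosure _ _)

/-- The subspace of `W̃` of degree `n`. -/
def tildeGrade (n : ℤ) : Submodule 𝕂 D.WTilde := (freeGrade 𝕂 D.genDegree n).map D.relIdeal.mkQ

/-- `I` is a graded ideal of `W̃` which intersects the local part `W̃_{-1} ⊕ W̃_0 ⊕ W̃_1`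
trivially. -/
def IsGradedPeripheral (I : Submodule 𝕂 D.WTilde) : Prop :=
  IsIdealFor D.tildeBracket I ∧ (I = ⨆ n : ℤ, I ⊓ D.tildeGrade n) ∧
    Disjoint I (D.tildeGrade (-1) ⊔ D.tildeGrade 0 ⊔ D.tildeGrade 1)

/-- The maximal graded ideal of `W̃` intersecting the local part trivially (the sum of all such
ideals). -/
def maxIdeal : Submodule 𝕂 D.WTilde := sSup {I | D.IsGradedPeripheral I}

/-- The tensor hierarchy algebra `W`. -/
def W : Type u := D.WTilde ⧸ D.maxIdeal

instance : AddCommGroup D.W := inferInstanceAs (AddCommGroup (D.WTilde ⧸ D.maxIdeal))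
instance : Module 𝕂 D.W := inferInstanceAs (Module 𝕂 (D.WTilde ⧸ D.maxIdeal))

/-- The bracket of `W`. -/
def wBracket : D.W →ₗ[𝕂] D.W →ₗ[𝕂] D.W :=
  quotBracket D.tildeBracket D.maxIdeal (isIdealFor_sSup _ _ fun _ hI => hI.1)

/-- The projection from the free nonassociative algebra onto `W`. -/
def toW : D.FreeAlg →ₗ[𝕂] D.W := D.maxIdeal.mkQ ∘ₗ D.relIdeal.mkQ

/-- The subspace `W_n` of degree `n`. -/
def wGrade (n : ℤ) : Submodule 𝕂 D.W := (freeGrade 𝕂 D.genDegree n).map D.toW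

/-- The generators of `W`. -/
def we (i : Option (Fin r)) : D.W := D.toW (D.fe i)
/-- The generators of `W`. -/
def wf (i : Fin r) : D.W := D.toW (D.ff i)
/-- The generators of `W`. -/
def wh (i : Option (Fin r)) : D.W := D.toW (D.fh i)
/-- The generators of `W`. -/
def wf0 (i : Option D.K) : D.W := D.toW (D.ff0 i)

theorem toW_surjective : Function.Surjective D.toW :=
  (Submodule.mkQ_surjective _).comp (Submodule.mkQ_surjective _)

@[simp]
theorem toW_mul (x y : D.FreeAlg) : D.toW (x * y) = D.wBracket (D.toW x) (D.toW y) := rfl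

theorem toW_eq_zero {x : D.FreeAlg}
    (hx : x ∈ superRelations 𝕂 D.genDegree ∪ {w | D.Rel w}) : D.toW x = 0 := by
  have h : D.relIdeal.mkQ x = 0 := by
    rw [Submodule.mkQ_apply, Submodule.Quotient.mk_eq_zero]
    exact subset_idealClosure _ _ hx
  change D.maxIdeal.mkQ (D.relIdeal.mkQ x) = 0
  rw [h, map_zero]

theorem toW_rel {x : D.FreeAlg} (hx : D.Rel x) : D.toW x = 0 := D.toW_eq_zero (Or.inr hx)

theorem wBracket_mem {m n : ℤ} {x y : D.W} (hx : x ∈ D.wGrade m) (hy : y ∈ D.wGrade n) :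
    D.wBracket x y ∈ D.wGrade (m + n) := by
  obtain ⟨a, ha, rfl⟩ := hx
  obtain ⟨b, hb, rfl⟩ := hy
  exact ⟨a * b, mul_mem_freeGrade 𝕂 _ ha hb, rfl⟩

theorem wBracket_skew {m n : ℤ} {x y : D.W} (hx : x ∈ D.wGrade m) (hy : y ∈ D.wGrade n) :
    D.wBracket x y = -((m * n).negOnePow • D.wBracket y x) := by
  obtain ⟨a, ha, rfl⟩ := hx
  obtain ⟨b, hb, rfl⟩ := hy
  have h := D.toW_eq_zero (Or.inl (Or.inl ⟨m, n, a, ha, b, hb, rfl⟩))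
  rw [map_add, Units.smul_def, map_zsmul, toW_mul, toW_mul, ← Units.smul_def] at h
  exact eq_neg_of_add_eq_zero_left h

theorem wBracket_jacobi {m n : ℤ} {x y : D.W} (hx : x ∈ D.wGrade m) (hy : y ∈ D.wGrade n)
    (z : D.W) :
    D.wBracket x (D.wBracket y z) =
      D.wBracket (D.wBracket x y) z + (m * n).negOnePow • D.wBracket y (D.wBracket x z) := by
  obtain ⟨a, ha, rfl⟩ := hx
  obtain ⟨b, hb, rfl⟩ := hy
  obtain ⟨c, rfl⟩ := D.toW_surjective z
  have h := D.toW_eq_zero (Or.inl (Or.inr ⟨m, n, a, ha, b, hb, c, rfl⟩))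
  rw [map_sub, map_sub, Units.smul_def, map_zsmul, ← Units.smul_def] at h
  simp only [toW_mul] at h
  rw [sub_sub, sub_eq_zero] at h
  exact h

/-! ### The even subalgebra `W_0` and the homomorphism from `𝔤` -/

/-- The subalgebra `W_0` of degree `0`. -/
def W0 : Type u := D.wGrade 0

instance : AddCommGroup D.W0 := inferInstanceAs (AddCommGroup (D.wGrade 0))
instance : Module 𝕂 D.W0 := inferInstanceAs (Module 𝕂 (D.wGrade 0))

/-- The inclusion of `W_0` into `W`. -/
def W0.incl : D.W0 →ₗ[𝕂] D.W := (D.wGrade 0).subtype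

theorem W0.incl_injective : Function.Injective (W0.incl D) := Subtype.val_injective

theorem W0.incl_mem (x : D.W0) : W0.incl D x ∈ D.wGrade 0 := Subtype.property x

instance : Bracket D.W0 D.W0 :=
  ⟨fun x y => ⟨D.wBracket (W0.incl D x) (W0.incl D y),
    by simpa using D.wBracket_mem (W0.incl_mem D x) (W0.incl_mem D y)⟩⟩

theorem W0.incl_lie (x y : D.W0) :
    W0.incl D ⁅x, y⁆ = D.wBracket (W0.incl D x) (W0.incl D y) := rfl

theorem wBracket_skew0 {x y : D.W} (hx : x ∈ D.wGrade 0) (hy : y ∈ D.wGrade 0) :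
    D.wBracket x y = -D.wBracket y x := by
  simpa using D.wBracket_skew hx hy

theorem wBracket_jacobi0 {x y : D.W} (hx : x ∈ D.wGrade 0) (hy : y ∈ D.wGrade 0) (z : D.W) :
    D.wBracket x (D.wBracket y z) =
      D.wBracket (D.wBracket x y) z + D.wBracket y (D.wBracket x z) := by
  simpa using D.wBracket_jacobi hx hy z

theorem we_mem (i : Fin r) : D.we (some i) ∈ D.wGrade 0 :=
  ⟨_, of_mem_freeGrade 𝕂 D.genDegree (Gen.e (some i)), rfl⟩

theorem wf_mem (i : Fin r) : D.wf i ∈ D.wGrade 0 :=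
  ⟨_, of_mem_freeGrade 𝕂 D.genDegree (Gen.f i), rfl⟩

theorem wh_mem (i : Option (Fin r)) : D.wh i ∈ D.wGrade 0 :=
  ⟨_, of_mem_freeGrade 𝕂 D.genDegree (Gen.h i), rfl⟩

/-- The images of the Chevalley generators of `𝔤`. -/
def genImage : CartanMatrix.Generators (Fin r) → D.W0
  | CartanMatrix.Generators.H i => ⟨D.wh (some i), D.wh_mem _⟩
  | CartanMatrix.Generators.E i => ⟨D.we (some i), D.we_mem _⟩
  | CartanMatrix.Generators.F i => ⟨D.wf i, D.wf_mem _⟩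

theorem w_ef (i j : Fin r) :
    D.wBracket (D.we (some i)) (D.wf j) = if i = j then D.wh (some i) else 0 := by
  have h := D.toW_rel (Rel.ef (some i) j)
  rw [map_sub, toW_mul, sub_eq_zero] at h
  refine h.trans ?_
  by_cases hij : i = j
  · subst hij; simp [wh]
  · simp [hij]

theorem w_he (i j : Option (Fin r)) :
    D.wBracket (D.wh i) (D.we j) = D.B i j • D.we j := by
  have h := D.toW_rel (Rel.he i j)
  rw [map_sub, toW_mul, sub_eq_zero, map_smul] at h
  exact h

theorem w_hf (i : Option (Fin r)) (j : Fin r) :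
    D.wBracket (D.wh i) (D.wf j) = -(D.B i (some j) • D.wf j) := by
  have h := D.toW_rel (Rel.hf i j)
  rw [map_add, toW_mul, map_smul] at h
  exact eq_neg_of_add_eq_zero_left h

theorem w_hh (i : Option (Fin r)) (j : Fin r) :
    D.wBracket (D.wh i) (D.wh (some j)) = 0 := by
  have h := D.w_ef j j
  rw [if_pos rfl] at h
  rw [← h, D.wBracket_jacobi0 (D.wh_mem _) (D.we_mem _), D.w_he, D.w_hf]
  simp

theorem toW_adPow (x : D.FreeAlg) (n : ℕ) (y : D.FreeAlg) :
    D.toW (D.adPow x n y) = (D.wBracket (D.toW x) ^ n) (D.toW y) := by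
  induction n with
  | zero => rfl
  | succ n ih =>
    rw [adPow, Function.iterate_succ_apply', toW_mul, ih, pow_succ', Module.End.mul_apply]

theorem map_ad_pow {L L' : Type*} [LieRing L] [LieAlgebra 𝕂 L] [LieRing L'] [LieAlgebra 𝕂 L']
    (φ : L →ₗ⁅𝕂⁆ L') (x : L) (n : ℕ) (y : L) :
    φ ((LieAlgebra.ad 𝕂 L x ^ n) y) = (LieAlgebra.ad 𝕂 L' (φ x) ^ n) (φ y) := by
  induction n with
  | zero => rfl
  | succ n ih =>
    rw [pow_succ', pow_succ', Module.End.mul_apply, Module.End.mul_apply, LieAlgebra.ad_apply,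
      LieHom.map_lie, ih, LieAlgebra.ad_apply]

theorem serre_toNat {a : ℤ} (h : a ≤ 0) : (a : 𝕂) = -((-a).toNat : 𝕂) := by
  have : ((-a).toNat : ℤ) = -a := Int.toNat_of_nonneg (by omega)
  have h2 : (((-a).toNat : ℤ) : 𝕂) = ((-a : ℤ) : 𝕂) := by rw [this]
  rw [Int.cast_natCast] at h2
  rw [h2]; simp

variable [CharZero 𝕂]

instance : LieRing D.W0 where
  add_lie x y z := W0.incl_injective D (by simp [W0.incl_lie])
  lie_add x y z := W0.incl_injective D (by simp [W0.incl_lie])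
  lie_self x := W0.incl_injective D (by
    have h := D.wBracket_skew0 (W0.incl_mem D x) (W0.incl_mem D x)
    rw [W0.incl_lie, map_zero]
    have h2 : (2 : 𝕂) • D.wBracket (W0.incl D x) (W0.incl D x) = 0 := by
      rw [two_smul]
      exact add_eq_zero_iff_eq_neg.2 h
    exact (smul_eq_zero.1 h2).resolve_left two_ne_zero)
  leibniz_lie x y z := W0.incl_injective D (by
    simp only [W0.incl_lie, map_add]
    exact D.wBracket_jacobi0 (W0.incl_mem D x) (W0.incl_mem D y) _)

instance : LieAlgebra 𝕂 D.W0 where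
  lie_smul c x y := W0.incl_injective D (by simp [W0.incl_lie])

theorem incl_ad_pow (x : D.W0) (n : ℕ) (y : D.W0) :
    W0.incl D ((LieAlgebra.ad 𝕂 D.W0 x ^ n) y) =
      (D.wBracket (W0.incl D x) ^ n) (W0.incl D y) := by
  induction n with
  | zero => rfl
  | succ n ih =>
    rw [pow_succ', pow_succ', Module.End.mul_apply, Module.End.mul_apply, LieAlgebra.ad_apply,
      W0.incl_lie, ih]

/-- The homomorphism from the free Lie algebra to `W_0`. -/
def freeToW0 : FreeLieAlgebra 𝕂 (CartanMatrix.Generators (Fin r)) →ₗ⁅𝕂⁆ D.W0 :=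
  FreeLieAlgebra.lift 𝕂 D.genImage

theorem toIdeal_le_ker :
    CartanMatrix.Relations.toIdeal 𝕂 D.A ≤ D.freeToW0.ker := by
  rw [CartanMatrix.Relations.toIdeal, LieSubmodule.lieSpan_le]
  have hof : ∀ x, D.freeToW0 (FreeLieAlgebra.of 𝕂 x) = D.genImage x :=
    fun x => FreeLieAlgebra.lift_of_apply D.genImage x
  rintro x (((((⟨⟨i, j⟩, rfl⟩ | ⟨⟨i, j⟩, rfl⟩) | ⟨⟨i, j⟩, rfl⟩) | ⟨⟨i, j⟩, rfl⟩) | ⟨⟨i, j⟩, rfl⟩) |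
    ⟨⟨i, j⟩, rfl⟩) <;> simp only [SetLike.mem_coe, LieHom.mem_ker] <;>
    apply W0.incl_injective D <;> rw [map_zero]
  · simp only [CartanMatrix.Relations.HH, Function.uncurry, Function.comp, LieHom.map_lie, hof,
      W0.incl_lie]
    exact D.w_hh _ _
  · have h := D.w_ef i j
    by_cases hij : i = j
    · subst hij
      simp only [CartanMatrix.Relations.EF, Function.uncurry, Function.comp, if_true,
        map_sub, LieHom.map_lie, hof, W0.incl_lie, map_sub]
      rw [if_pos rfl] at h
      exact sub_eq_zero.2 h
    · simp only [CartanMatrix.Relations.EF, Function.uncurry, Function.comp, if_neg hij,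
        LieHom.map_lie, hof, W0.incl_lie]
      rw [if_neg hij] at h
      exact h
  · simp only [CartanMatrix.Relations.HE, Function.uncurry, Function.comp,
      map_sub, LieHom.map_lie, hof, W0.incl_lie, map_sub, map_zsmul]
    rw [← Int.cast_smul_eq_zsmul 𝕂]
    exact sub_eq_zero.2 (D.w_he (some i) (some j))
  · simp only [CartanMatrix.Relations.HF, Function.uncurry, Function.comp,
      map_add, LieHom.map_lie, hof, W0.incl_lie, map_add, map_zsmul]
    rw [← Int.cast_smul_eq_zsmul 𝕂]
    exact add_eq_zero_iff_eq_neg.2 (D.w_hf (some i) j)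
  · by_cases hij : i = j
    · subst hij
      simp [CartanMatrix.Relations.adE, Function.uncurry]
    · simp only [CartanMatrix.Relations.adE, Function.uncurry, Function.comp, map_ad_pow,
        LieHom.map_lie, hof, incl_ad_pow, W0.incl_lie]
      have h := D.toW_rel (Rel.serreE (some i) (some j) _ (serre_toNat (D.A_offdiag i j hij)))
      rw [toW_adPow, pow_succ, Module.End.mul_apply] at h
      exact h
  · by_cases hij : i = j
    · subst hij
      simp [CartanMatrix.Relations.adF, Function.uncurry]
    · simp only [CartanMatrix.Relations.adF, Function.uncurry, Function.comp, map_ad_pow,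
        LieHom.map_lie, hof, incl_ad_pow, W0.incl_lie]
      have h := D.toW_rel (Rel.serreF i j _ (serre_toNat (D.A_offdiag i j hij)))
      rw [toW_adPow, pow_succ, Module.End.mul_apply] at h
      exact h

/-- The canonical homomorphism `𝔤 → W_0` of Lie algebras sending each of the generators `e_i`, `f_i`,
`h_i` (for `i ∈ I`) of `𝔤` to the generator of `W` with the same name. -/
def gToW0 : D.g →ₗ⁅𝕂⁆ D.W0 :=
  { (CartanMatrix.Relations.toIdeal 𝕂 D.A).toSubmodule.liftQ
      (D.freeToW0 : FreeLieAlgebra 𝕂 (CartanMatrix.Generators (Fin r)) →ₗ[𝕂] D.W0)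
      (fun _ hx => D.toIdeal_le_ker hx) with
    map_lie' := by
      rintro ⟨x⟩ ⟨y⟩
      exact D.freeToW0.map_lie x y }

/-- The canonical linear map `𝔤 → W`. -/
def gToW : D.g →ₗ[𝕂] D.W := W0.incl D ∘ₗ (D.gToW0 : D.g →ₗ[𝕂] D.W0)

@[simp]
theorem gToW_e (i : Fin r) : D.gToW (gE 𝕂 D.A i) = D.we (some i) :=
  congrArg (W0.incl D) (FreeLieAlgebra.lift_of_apply (R := 𝕂) D.genImage (CartanMatrix.Generators.E i))

@[simp]
theorem gToW_f (i : Fin r) : D.gToW (gF 𝕂 D.A i) = D.wf i :=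
  congrArg (W0.incl D) (FreeLieAlgebra.lift_of_apply (R := 𝕂) D.genImage (CartanMatrix.Generators.F i))

@[simp]
theorem gToW_h (i : Fin r) : D.gToW (gH 𝕂 D.A i) = D.wh (some i) :=
  congrArg (W0.incl D) (FreeLieAlgebra.lift_of_apply (R := 𝕂) D.genImage (CartanMatrix.Generators.H i))

theorem gToW_mem (x : D.g) : D.gToW x ∈ D.wGrade 0 := W0.incl_mem D _

theorem gToW_lie (x y : D.g) : D.gToW ⁅x, y⁆ = D.wBracket (D.gToW x) (D.gToW y) := by
  change W0.incl D (D.gToW0 ⁅x, y⁆) = _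
  rw [LieHom.map_lie]
  rfl

/-- `𝔤` acts on `W` by the bracket of `W`. -/
instance : LieRingModule D.g D.W where
  bracket x w := D.wBracket (D.gToW x) w
  add_lie x y w := by
    simp
  lie_add x v w := map_add (D.wBracket (D.gToW x)) v w
  leibniz_lie x y w := by
    change D.wBracket (D.gToW x) (D.wBracket (D.gToW y) w) =
      D.wBracket (D.gToW ⁅x, y⁆) w + D.wBracket (D.gToW y) (D.wBracket (D.gToW x) w)
    rw [gToW_lie]
    exact D.wBracket_jacobi0 (D.gToW_mem x) (D.gToW_mem y) w

theorem g_lie_def (x : D.g) (w : D.W) : ⁅x, w⁆ = D.wBracket (D.gToW x) w := rfl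

instance : LieModule 𝕂 D.g D.W where
  smul_lie c x w := by simp [g_lie_def]
  lie_smul c x w := by simp [g_lie_def]

end Datum

namespace Datum

variable {𝕂 : Type u} [Field 𝕂] {r : ℕ} (D : Datum 𝕂 r)

/-! ### The subalgebra `𝔤⁻`, its weights and roots -/

/-- The subalgebra `𝔤⁻` of `𝔤` generated by `e_k`, `f_k`, `h_k` for `k ∈ K`. -/
def gMinus : LieSubalgebra 𝕂 D.g :=
  LieSubalgebra.lieSpan 𝕂 D.g
    {x | ∃ k : D.K, x = gE 𝕂 D.A k ∨ x = gF 𝕂 D.A k ∨ x = gH 𝕂 D.A k}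

/-- The Cartan elements `h_k` of `𝔤⁻`. -/
def hMinus (k : D.K) : D.gMinus :=
  ⟨gH 𝕂 D.A k, LieSubalgebra.subset_lieSpan ⟨k, Or.inr (Or.inr rfl)⟩⟩

/-- The Cartan subalgebra of `𝔤⁻`, spanned by the elements `h_k`. -/
def cartan : Submodule 𝕂 D.gMinus := Submodule.span 𝕂 (Set.range D.hMinus)

/-- The restriction of `κ` to the Cartan subalgebra of `𝔤⁻`. -/
def κCartan : LinearMap.BilinForm 𝕂 D.cartan :=
  D.κ.compl₁₂ (D.gMinus.toSubmodule.subtype ∘ₗ D.cartan.subtype)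
    (D.gMinus.toSubmodule.subtype ∘ₗ D.cartan.subtype)

@[simp]
theorem κCartan_apply (x y : D.cartan) :
    D.κCartan x y = D.κ ((x : D.gMinus) : D.g) ((y : D.gMinus) : D.g) := rfl

theorem κ_hh (i j : Fin r) :
    D.κ (gH 𝕂 D.A i) (gH 𝕂 D.A j) = D.ε i * (D.A j i : 𝕂) := by
  rw [← g_ef, D.κ_inv, ← lie_skew, g_hf, neg_neg, map_smul, D.κ_ef, if_pos rfl, smul_eq_mul,
    mul_comm]

theorem coeff_eq_zero [CharZero 𝕂] (c : D.K → 𝕂)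
    (hc : ∀ l : D.K, ∑ k, c k * (D.ε k * (D.A l k : 𝕂)) = 0) : ∀ k, c k = 0 := by
  have hdet : ((D.A.submatrix (Subtype.val : D.K → Fin r) Subtype.val).map
      (Int.cast : ℤ → 𝕂)).det ≠ 0 := by
    have h := Int.cast_det (R := 𝕂) (D.A.submatrix (Subtype.val : D.K → Fin r) Subtype.val)
    rw [← h]
    exact_mod_cast D.AK_det
  have h0 : ((D.A.submatrix (Subtype.val : D.K → Fin r) Subtype.val).map
      (Int.cast : ℤ → 𝕂)).mulVec (fun k => c k * D.ε k) = 0 := by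
    funext l
    rw [Pi.zero_apply, ← hc l]
    simp only [Matrix.mulVec, dotProduct, Matrix.map_apply, Matrix.submatrix_apply]
    exact Finset.sum_congr rfl fun k _ => by ring
  intro k
  have h3 := congrFun (Matrix.eq_zero_of_mulVec_eq_zero hdet h0) k
  exact (mul_eq_zero.1 h3).resolve_right (D.ε_ne k)

theorem hMinus_linearIndependent [CharZero 𝕂] : LinearIndependent 𝕂 D.hMinus := by
  rw [Fintype.linearIndependent_iff]
  intro c hc
  refine D.coeff_eq_zero c fun l => ?_
  have h1 := congrArg (fun x : D.gMinus => D.κ (x : D.g) (gH 𝕂 D.A l)) hc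
  have h2 : ((∑ k, c k • D.hMinus k : D.gMinus) : D.g) = ∑ k, c k • gH 𝕂 D.A (k : Fin r) := by
    change D.gMinus.toSubmodule.subtype _ = _
    rw [map_sum]
    rfl
  simpa only [h2, map_sum, map_smul, LinearMap.sum_apply, LinearMap.smul_apply, κ_hh,
    ZeroMemClass.coe_zero, map_zero, LinearMap.zero_apply, smul_eq_mul] using h1

variable [CharZero 𝕂]

/-- The basis `(h_k)` of the Cartan subalgebra of `𝔤⁻`. -/
def cartanBasis : Module.Basis D.K 𝕂 D.cartan :=
  Module.Basis.span D.hMinus_linearIndependent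

theorem cartanBasis_apply (k : D.K) : (D.cartanBasis k : D.gMinus) = D.hMinus k :=
  congrArg Subtype.val (Module.Basis.span_apply D.hMinus_linearIndependent k)

/-- A weight of `𝔤⁻` is a linear functional on its Cartan subalgebra. -/
abbrev Weight : Type u := Module.Dual 𝕂 D.cartan

/-- The simple roots of `𝔤⁻`: `α_k(h_l) = A_lk`. -/
def simpleRoot (k : D.K) : D.Weight := D.cartanBasis.constr 𝕂 fun l => (D.A l k : 𝕂)

theorem simpleRoot_apply (k l : D.K) : D.simpleRoot k (D.cartanBasis l) = (D.A l k : 𝕂) := by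
  simp [simpleRoot]

theorem κCartan_basis (k : D.K) : D.κCartan (D.cartanBasis k) = D.ε k • D.simpleRoot k := by
  refine D.cartanBasis.ext fun l => ?_
  rw [LinearMap.smul_apply, simpleRoot_apply, κCartan_apply, cartanBasis_apply, cartanBasis_apply]
  exact D.κ_hh k l

instance : FiniteDimensional 𝕂 D.cartan := Module.Finite.of_basis D.cartanBasis

theorem κCartan_symm (x y : D.cartan) : D.κCartan x y = D.κCartan y x := D.κ_symm _ _

theorem κCartan_separating (x : D.cartan) (hx : ∀ y, D.κCartan x y = 0) : x = 0 := by
  have h : ∀ k, D.cartanBasis.repr x k = 0 := by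
    refine D.coeff_eq_zero _ fun l => ?_
    have h1 := hx (D.cartanBasis l)
    rw [← D.cartanBasis.sum_repr x] at h1
    simpa only [map_sum, map_smul, LinearMap.sum_apply, LinearMap.smul_apply, smul_eq_mul,
      κCartan_basis, simpleRoot_apply] using h1
  rw [← D.cartanBasis.sum_repr x]
  simp [h]

theorem κCartan_nondegenerate : D.κCartan.Nondegenerate :=
  ⟨D.κCartan_separating, fun y hy => D.κCartan_separating y fun x =>
    (D.κCartan_symm y x).trans (hy x)⟩

/-- The isomorphism `φ` from the Cartan subalgebra of `𝔤⁻` to its dual,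
`φ(h)(h') = κ(h, h')`. -/
def φ : D.cartan ≃ₗ[𝕂] D.Weight := D.κCartan.toDual D.κCartan_nondegenerate

/-- The bilinear form `(μ, ν) = κ(φ⁻¹(μ), φ⁻¹(ν))` on the weights of `𝔤⁻`. -/
def form (μ ν : D.Weight) : 𝕂 := D.κCartan (D.φ.symm μ) (D.φ.symm ν)

/-- The basis of the space of weights of `𝔤⁻` formed by `α_k^∨ = κ(e_k, f_k) α_k`. -/
def corootBasis : Module.Basis D.K 𝕂 D.Weight := D.cartanBasis.map D.φ

theorem corootBasis_apply (k : D.K) : D.corootBasis k = D.ε k • D.simpleRoot k :=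
  (D.cartanBasis.map_apply D.φ k).trans (LinearMap.ext fun y =>
    (LinearMap.BilinForm.toDual_def D.κCartan_nondegenerate).trans
      (LinearMap.congr_fun (D.κCartan_basis k) y))

/-- `f_{0μ^∨}`: the linear combination of the `f_{0k}` for `k ∈ K` with the same coefficients as `μ`
in the basis `(α_k^∨)`. -/
def f0vee (μ : D.Weight) : D.W := ∑ k, D.corootBasis.repr μ k • D.wf0 (some k)

/-- The space of those `x ∈ 𝔤⁻` with `[h, x] = α(h) x` for all `h` in the Cartan subalgebra. -/
def rootSpace (α : D.Weight) : Submodule 𝕂 D.gMinus where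
  carrier := {x | ∀ h : D.cartan, ⁅(h : D.gMinus), x⁆ = α h • x}
  add_mem' := by
    intro x y hx hy h
    rw [lie_add, hx, hy, smul_add]
  zero_mem' := by simp
  smul_mem' := by
    intro c x hx h
    rw [lie_smul, hx, smul_comm]

/-- `α` is a root of `𝔤⁻`. -/
def IsRoot (α : D.Weight) : Prop := α ≠ 0 ∧ D.rootSpace α ≠ ⊥

/-- The linear map `s` is the map `♯`: it satisfies `e_α^♯ = [e_α, f_{0μ^∨}] / (μ, α)` for every root
`α`, every root vector `e_α` and every weight `μ` with `(μ, α) ≠ 0`, and `h_k^♯ = -f_{0k}`. -/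
structure IsSharp (s : D.gMinus →ₗ[𝕂] D.W) : Prop where
  root : ∀ α : D.Weight, D.IsRoot α → ∀ x ∈ D.rootSpace α, ∀ μ : D.Weight, D.form μ α ≠ 0 →
    s x = (D.form μ α)⁻¹ • ⁅x, D.f0vee μ⁆
  cartan : ∀ k : D.K, s (D.hMinus k) = -D.wf0 (some k)

/-- The `𝔤⁻`-submodule of `W` generated by the elements `f_{0k}` for `k ∈ K`. -/
def f0Module : LieSubmodule 𝕂 D.gMinus D.W :=
  LieSubmodule.lieSpan 𝕂 D.gMinus (Set.range fun k : D.K => D.wf0 (some k))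

/-- The canonical map `𝔤⁻ → W`, as a homomorphism from the adjoint module of `𝔤⁻` to `W`. -/
def gMinusToW : D.gMinus →ₗ⁅𝕂, D.gMinus⁆ D.W :=
  { D.gToW ∘ₗ D.gMinus.toSubmodule.subtype with
    map_lie' := by
      intro x y
      exact D.gToW_lie x y }


end Datum

end THA

end

/-! The map `♯` is, up to sign, the unique module homomorphism from the adjoint module of `𝔤⁻` that
sends `h_k` to a prescribed vector. The vectors `-f_{0k}` satisfy the same relations under `e_k`,
`f_k`, `h_k` as the elements `h_k` of the adjoint module (`IsCartanLike`), and the main point is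
that these relations suffice for such a homomorphism to exist (`IsCartanLike.exists_lieModuleHom`).

Any module generated by Cartan-like vectors `v_i` is a sum of raising monomials, the span of the
`v_i`, and lowering monomials (`lieSpan_eq_triangular`). Its zero weight space is therefore the span
of the `v_i`, and no weight has coefficients of both signs. Let a submodule avoid the span of the
`v_i`. A nonzero weight vector in it of least height would be annihilated by all `f_l`, or by all
`e_l`. By `sl₂` theory its weight `c` would satisfy `c ≥ 0` and `Ac ≤ 0`, up to symmetry, which the
finite type of `A` forbids unless `c = 0`. So the submodule is zero (`eq_bot_of_disjoint_span`);
this is the only use of finite-dimensionality.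

Apply this to the submodule of `L × M` generated by the pairs `(h_i, v_i)`. The part of it with zero
first component avoids the span of these pairs, since the `h_i` are independent, and hence vanishes.
The submodule is thus the graph of the homomorphism.

Equivariance yields the formula on root vectors, and that formula determines the map, because root
vectors and the `h_k` span `𝔤⁻`. For the kernel, `e_0` is `𝔤⁻`-invariant and `[e_0, f_{0k}] = h_k`,
so bracketing with `e_0` carries `x^♯` to minus the image of `x` in `W`. This gives one inclusion;
the other is `IsCartanLike.ideal_le_ker`. -/

noncomputable section

set_option linter.unusedSectionVars false

namespace THA

/-! ### Chevalley generators, Cartan-like vectors and weight components. -/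

section Chevalley

variable {𝕂 L M ι : Type*} [Field 𝕂] [LieRing L] [LieAlgebra 𝕂 L]
  [AddCommGroup M] [Module 𝕂 M] [LieRingModule L M] [LieModule 𝕂 L M]
  [DecidableEq ι]

/-- The elements `e`, `f`, `h` generate the Lie algebra `L` and satisfy the Chevalley–Serre
relations of an invertible matrix `A` with diagonal entries `2`. -/
structure IsChevalley (𝕂 : Type*) [Field 𝕂] [LieAlgebra 𝕂 L] [Fintype ι] (A : Matrix ι ι ℤ)
    (e f h : ι → L) : Prop where
  ef : ∀ i j, ⁅e i, f j⁆ = if i = j then h i else 0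
  he : ∀ i j, ⁅h i, e j⁆ = (A i j : 𝕂) • e j
  hf : ∀ i j, ⁅h i, f j⁆ = -((A i j : 𝕂) • f j)
  hh : ∀ i j, ⁅h i, h j⁆ = 0
  lieSpan_eq : LieSubalgebra.lieSpan 𝕂 L (Set.range e ∪ Set.range f) = ⊤
  serreE : ∀ i j, ∃ n, (LieAlgebra.ad 𝕂 L (e i) ^ n) (e j) = 0
  serreF : ∀ i j, ∃ n, (LieAlgebra.ad 𝕂 L (f i) ^ n) (f j) = 0
  diag : ∀ i, A i i = 2
  det_ne : A.det ≠ 0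

/-- The elements `v i` of an `L`-module satisfy the relations satisfied by the elements `h i` of the
adjoint module. -/
structure IsCartanLike (𝕂 : Type*) [Field 𝕂] [Module 𝕂 M] (A : Matrix ι ι ℤ) (e f h : ι → L)
    (v : ι → M) : Prop where
  hv : ∀ i j, ⁅h i, v j⁆ = 0
  efv : ∀ k l i, ⁅e k, ⁅f l, v i⁆⁆ = if k = l then (A i l : 𝕂) • v k else 0
  eev : ∀ k i, ⁅e k, ⁅e k, v i⁆⁆ = 0
  ffv : ∀ k i, ⁅f k, ⁅f k, v i⁆⁆ = 0

/-- The subspace of weight `∑ k, c k • α k`, where `α k` is the `k`-th column of `A`. -/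
def weightSubmodule (𝕂 : Type*) [Field 𝕂] [LieAlgebra 𝕂 L] (M : Type*) [AddCommGroup M] [Module 𝕂 M]
    [LieRingModule L M] [LieModule 𝕂 L M] [Fintype ι] (A : Matrix ι ι ℤ) (h : ι → L) (c : ι → ℤ) :
    Submodule 𝕂 M where
  carrier := {m | ∀ k, ⁅h k, m⁆ = ((A.mulVec c k : ℤ) : 𝕂) • m}
  add_mem' := by
    intro x y hx hy k
    rw [lie_add, hx, hy, smul_add]
  zero_mem' := by simp
  smul_mem' := by
    intro a x hx k
    rw [lie_smul, hx, smul_comm]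

/-- The iterated bracket `[e_{j₁}, [e_{j₂}, …, [e_k, v_k]]]`. -/
def monomial (e : ι → L) (v : ι → M) (k : ι) (l : List ι) : M :=
  l.foldr (fun j m => ⁅e j, m⁆) ⁅e k, v k⁆

/-- The span of all iterated brackets of elements `e_j` with some `[e_k, v_k]`. -/
def raisingSpan (𝕂 : Type*) [Field 𝕂] [Module 𝕂 M] (e : ι → L) (v : ι → M) : Submodule 𝕂 M :=
  Submodule.span 𝕂 (Set.range fun p : ι × List ι => monomial e v p.1 p.2)

theorem lie_mem_of_lieSpan_eq_top {e f : ι → L}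
    (hL : LieSubalgebra.lieSpan 𝕂 L (Set.range e ∪ Set.range f) = ⊤) (P : Submodule 𝕂 M)
    (he : ∀ i, ∀ m ∈ P, ⁅e i, m⁆ ∈ P) (hf : ∀ i, ∀ m ∈ P, ⁅f i, m⁆ ∈ P) (x : L) :
    ∀ m ∈ P, ⁅x, m⁆ ∈ P := by
  have hx : x ∈ LieSubalgebra.lieSpan 𝕂 L (Set.range e ∪ Set.range f) := hL ▸ trivial
  induction hx using LieSubalgebra.lieSpan_induction with
  | mem x hx =>
    rcases hx with ⟨i, rfl⟩ | ⟨i, rfl⟩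
    · exact he i
    · exact hf i
  | zero => simp
  | add x y _ _ hx hy => intro m hm; rw [add_lie]; exact add_mem (hx m hm) (hy m hm)
  | smul a x _ hx => intro m hm; rw [smul_lie]; exact P.smul_mem _ (hx m hm)
  | lie x y _ _ hx hy =>
    intro m hm
    rw [lie_lie]
    exact sub_mem (hx _ (hy m hm)) (hy _ (hx m hm))

variable [Fintype ι] {A : Matrix ι ι ℤ} {e f h : ι → L} {v : ι → M}

theorem mem_weightSubmodule {c : ι → ℤ} {m : M} :
    m ∈ weightSubmodule 𝕂 M A h c ↔ ∀ k, ⁅h k, m⁆ = ((A.mulVec c k : ℤ) : 𝕂) • m := Iff.rfl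

theorem mem_weightSubmodule_zero {m : M} :
    m ∈ weightSubmodule 𝕂 M A h 0 ↔ ∀ k, ⁅h k, m⁆ = 0 := by
  simp [mem_weightSubmodule]

theorem weightSubmodule_neg (c : ι → ℤ) :
    weightSubmodule 𝕂 M A (-h) c = weightSubmodule 𝕂 M A h (-c) := by
  ext m
  simp [mem_weightSubmodule, Matrix.mulVec_neg, neg_eq_iff_eq_neg]

theorem lie_mem_weightSubmodule {c : ι → ℤ} {m : M} (hm : m ∈ weightSubmodule 𝕂 M A h c)
    {d : ι → ℤ} {x : L} (hx : x ∈ weightSubmodule 𝕂 L A h d) :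
    ⁅x, m⁆ ∈ weightSubmodule 𝕂 M A h (c + d) := by
  intro k
  rw [leibniz_lie, hx k, hm k, lie_smul, smul_lie, ← add_smul, Matrix.mulVec_add]
  push_cast [Pi.add_apply]
  rw [add_comm]

/-- Obtained by grouping the terms of a linear combination of weight vectors according to their
weights. -/
theorem exists_weight_decomposition {σ : Type*} {b : σ → M} {wt : σ → ι → ℤ}
    (hb : ∀ i, b i ∈ weightSubmodule 𝕂 M A h (wt i)) {n : M}
    (hn : n ∈ Submodule.span 𝕂 (Set.range b)) :
    ∃ (s : Finset (ι → ℤ)) (m : (ι → ℤ) → M),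
      (∀ c, m c ∈ Submodule.span 𝕂 (b '' {i | wt i = c})) ∧
      (∀ c, m c ∈ weightSubmodule 𝕂 M A h c) ∧ (∀ c ∉ s, m c = 0) ∧ n = ∑ c ∈ s, m c := by
  obtain ⟨c, rfl⟩ := Finsupp.mem_span_range_iff_exists_finsupp.1 hn
  classical
  refine ⟨c.support.image wt, fun d => ∑ i ∈ c.support with wt i = d, c i • b i, ?_, ?_, ?_, ?_⟩
  · intro d
    refine Submodule.sum_mem _ fun i hi => Submodule.smul_mem _ _ (Submodule.subset_span ⟨i, ?_, rfl⟩)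
    exact (Finset.mem_filter.1 hi).2
  · intro d
    refine Submodule.sum_mem _ fun i hi => Submodule.smul_mem _ _ ?_
    rw [← (Finset.mem_filter.1 hi).2]
    exact hb i
  · intro d hd
    refine Finset.sum_eq_zero fun i hi => absurd ?_ hd
    rw [Finset.mem_filter] at hi
    exact Finset.mem_image.2 ⟨i, hi⟩
  · rw [Finset.sum_fiberwise_of_maps_to fun i hi => Finset.mem_image_of_mem _ hi]
    rfl

namespace IsChevalley

variable (H : IsChevalley 𝕂 A e f h)
include H

/-- The Chevalley involution: every statement about raising operators transfers to lowering
operators, with weights negated. -/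
theorem symm : IsChevalley 𝕂 A f e (-h) where
  ef i j := by
    rw [← lie_skew, H.ef]
    by_cases hij : i = j
    · subst hij; simp
    · simp [hij, Ne.symm hij]
  he i j := by simp [H.hf]
  hf i j := by simp [H.he]
  hh i j := by simp [H.hh]
  lieSpan_eq := by rw [Set.union_comm, H.lieSpan_eq]
  serreE := H.serreF
  serreF := H.serreE
  diag := H.diag
  det_ne := H.det_ne

theorem e_mem (k : ι) : e k ∈ weightSubmodule 𝕂 L A h (Pi.single k 1) := by
  intro i
  rw [H.he]
  simp

theorem f_mem (k : ι) : f k ∈ weightSubmodule 𝕂 L A h (-Pi.single k 1) := by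
  intro i
  rw [H.hf]
  simp [Matrix.mulVec_neg]

theorem lie_e_f (k : ι) (m : M) : ⁅e k, ⁅f k, m⁆⁆ = ⁅h k, m⁆ + ⁅f k, ⁅e k, m⁆⁆ := by
  rw [leibniz_lie, H.ef, if_pos rfl]

theorem lie_f_e (l k : ι) (m : M) :
    ⁅f l, ⁅e k, m⁆⁆ = ⁅e k, ⁅f l, m⁆⁆ - if k = l then ⁅h k, m⁆ else 0 := by
  rw [leibniz_lie (e k), H.ef]
  split_ifs <;> simp

/-- The model case: results on Cartan-like vectors thereby also describe the adjoint module. -/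
theorem isCartanLike : IsCartanLike 𝕂 A e f h h where
  hv := H.hh
  efv k l i := by
    rw [← lie_skew (f l), H.hf, neg_neg, lie_smul, H.ef]
    split_ifs <;> simp
  eev k i := by rw [← lie_skew (e k) (h i), H.he]; simp
  ffv k i := by rw [← lie_skew (f k) (h i), H.hf]; simp

theorem mulVec_injective : Function.Injective A.mulVec := by
  intro c d hcd
  have : A.mulVec (c - d) = 0 := by rw [Matrix.mulVec_sub, hcd, sub_self]
  exact sub_eq_zero.1 (Matrix.eq_zero_of_mulVec_eq_zero H.det_ne this)

/-- A submodule stable under the `h k` contains the weight components of its elements. -/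
theorem mem_of_sum_mem [CharZero 𝕂] {N : Submodule 𝕂 M} (hN : ∀ k, ∀ m ∈ N, ⁅h k, m⁆ ∈ N) {a : ι → ℤ}
    (s : Finset (ι → ℤ)) (has : a ∉ s) (m : (ι → ℤ) → M)
    (hm : ∀ c, m c ∈ weightSubmodule 𝕂 M A h c) (hs : m a + ∑ c ∈ s, m c ∈ N) : m a ∈ N := by
  induction s using Finset.induction_on generalizing m with
  | empty => simpa using hs
  | insert b s hb ih =>
    rw [Finset.mem_insert, not_or] at has
    obtain ⟨k, hk⟩ : ∃ k, A.mulVec a k ≠ A.mulVec b k := by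
      by_contra! h0
      exact has.1 (H.mulVec_injective (funext h0))
    let t : (ι → ℤ) → 𝕂 := fun c => ((A.mulVec c k - A.mulVec b k : ℤ) : 𝕂)
    have hta : t a ≠ 0 := by
      simp only [t]
      exact_mod_cast sub_ne_zero.2 hk
    -- The operator `h k - b(h k)` kills the component of weight `b` and multiplies that of weight
    -- `a` by the nonzero scalar `t a`, so the induction hypothesis applies to the shorter sum.
    have key : ∀ c, ⁅h k, m c⁆ - ((A.mulVec b k : ℤ) : 𝕂) • m c = t c • m c := by
      intro c
      rw [hm c k, ← sub_smul]
      simp [t]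
    have h1 := ih has.2 (fun c => t c • m c) (fun c => Submodule.smul_mem _ _ (hm c)) (by
      have h2 := sub_mem (hN k _ hs) (N.smul_mem ((A.mulVec b k : ℤ) : 𝕂) hs)
      rw [Finset.sum_insert hb] at h2
      have h3 : t b • m b = 0 := by simp [t]
      convert h2 using 1
      simp only [← key] at h3 ⊢
      rw [Finset.sum_sub_distrib, lie_add, lie_add, lie_sum, smul_add, smul_add, Finset.smul_sum]
      rw [sub_eq_zero] at h3
      rw [h3]
      abel)
    simpa [hta] using N.smul_mem (t a)⁻¹ h1

theorem mem_span_of_mem_weightSubmodule [CharZero 𝕂] {σ : Type*} {b : σ → M} {wt : σ → ι → ℤ}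
    (hb : ∀ i, b i ∈ weightSubmodule 𝕂 M A h (wt i)) {n : M}
    (hn : n ∈ Submodule.span 𝕂 (Set.range b)) {d : ι → ℤ} (hd : n ∈ weightSubmodule 𝕂 M A h d) :
    n ∈ Submodule.span 𝕂 (b '' {i | wt i = d}) := by
  obtain ⟨s, m, hm, hw, hs, rfl⟩ := exists_weight_decomposition hb hn
  classical
  set n := ∑ c ∈ s, m c with hn'
  -- Independence of weight components: subtracting `n` from its component of weight `d` gives a
  -- family of weight vectors with sum zero, so the modified component vanishes.
  have h1 := H.mem_of_sum_mem (N := (⊥ : Submodule 𝕂 M)) (by simp) (a := d) (s.erase d) (by simp)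
    (fun c => m c - if c = d then n else 0)
    (fun c => sub_mem (hw c) (by split_ifs with hc <;> [exact hc ▸ hd; exact zero_mem _])) (by
      have h2 : m d + ∑ c ∈ s.erase d, m c = n := by
        by_cases hds : d ∈ s
        · exact Finset.add_sum_erase _ _ hds
        · rw [hs d hds, Finset.erase_eq_of_notMem hds, zero_add]
      have h3 : ∑ c ∈ s.erase d, (m c - if c = d then n else 0) = ∑ c ∈ s.erase d, m c :=
        Finset.sum_congr rfl fun c hc => by simp [(Finset.mem_erase.1 hc).1]
      rw [h3, if_pos rfl, sub_add_eq_add_sub, h2, sub_self]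
      exact zero_mem _)
  rw [if_pos rfl, Submodule.mem_bot, sub_eq_zero] at h1
  exact h1 ▸ hm d

theorem eq_bot_of_weightSubmodule_disjoint [CharZero 𝕂] {σ : Type*} {b : σ → M} {wt : σ → ι → ℤ}
    (hb : ∀ i, b i ∈ weightSubmodule 𝕂 M A h (wt i)) {N : Submodule 𝕂 M}
    (hN : ∀ k, ∀ m ∈ N, ⁅h k, m⁆ ∈ N) (hspan : N ≤ Submodule.span 𝕂 (Set.range b))
    (h0 : ∀ i, ∀ n ∈ N, n ∈ weightSubmodule 𝕂 M A h (wt i) → n = 0) : N = ⊥ := by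
  rw [eq_bot_iff]
  intro n hn
  obtain ⟨s, m, hm, hw, hs, rfl⟩ := exists_weight_decomposition hb (hspan hn)
  refine Submodule.sum_mem _ fun c hc => ?_
  have hmN : m c ∈ N := by
    classical
    refine H.mem_of_sum_mem hN (s.erase c) (by simp) m hw ?_
    rwa [Finset.add_sum_erase _ _ hc]
  by_cases hi : ∃ i, wt i = c
  · obtain ⟨i, rfl⟩ := hi
    exact h0 i _ hmN (hw _)
  · have : b '' {i | wt i = c} = ∅ := by
      rw [Set.image_eq_empty]
      exact Set.eq_empty_of_forall_notMem fun i h => hi ⟨i, h⟩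
    simpa [this] using hm c

end IsChevalley

end Chevalley

/-! ### Triangular decomposition of the module generated by Cartan-like vectors. -/

section Triangular

variable {𝕂 L M ι : Type*} [Field 𝕂] [LieRing L] [LieAlgebra 𝕂 L]
  [AddCommGroup M] [Module 𝕂 M] [LieRingModule L M] [LieModule 𝕂 L M]
  [DecidableEq ι] [Fintype ι] {A : Matrix ι ι ℤ} {e f h : ι → L} {v : ι → M}

/-- The coefficients of the weight of `monomial e v k l` in terms of the simple roots. -/
def monomialWeight (k : ι) (l : List ι) : ι → ℤ := fun j => ((k :: l).count j : ℤ)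

theorem monomialWeight_nil (k : ι) : monomialWeight k [] = Pi.single k 1 := by
  funext j
  by_cases hj : k = j
  · subst hj; simp [monomialWeight]
  · simp [monomialWeight, hj, Ne.symm hj]

theorem monomialWeight_cons (k j : ι) (l : List ι) :
    monomialWeight k (j :: l) = monomialWeight k l + Pi.single j 1 := by
  funext i
  simp only [monomialWeight, Pi.add_apply, Pi.single_apply, List.count_cons, beq_iff_eq]
  push_cast
  simp only [eq_comm (a := j)]
  ring

theorem monomialWeight_nonneg (k : ι) (l : List ι) : 0 ≤ monomialWeight k l := fun j => by
  simp [monomialWeight]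

theorem monomialWeight_self_pos (k : ι) (l : List ι) : 0 < monomialWeight k l k := by
  simp [monomialWeight]

theorem monomial_cons (j k : ι) (l : List ι) :
    monomial e v k (j :: l) = ⁅e j, monomial e v k l⁆ := rfl

namespace IsCartanLike

variable (V : IsCartanLike 𝕂 A e f h v) (H : IsChevalley 𝕂 A e f h)

include V in
theorem mem_weight_zero (i : ι) : v i ∈ weightSubmodule 𝕂 M A h 0 :=
  mem_weightSubmodule_zero.2 fun k => V.hv k i

include V H

theorem symm : IsCartanLike 𝕂 A f e (-h) v where
  hv i j := by simp [V.hv]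
  efv k l i := by
    rw [H.lie_f_e (M := M), V.hv, V.efv]
    by_cases hkl : k = l
    · subst hkl; simp
    · simp [hkl, Ne.symm hkl]
  eev := V.ffv
  ffv := V.eev

/-- The combination `w = 2 v_i - A_ik v_k` is chosen so that `e_k f_k w = 0`. Then `e_k w` is
annihilated by both `e_k` and `f_k`, hence by `h_k`, while having `h_k`-eigenvalue `2`; so `e_k w =
0`. This is why monomials starting from `[e_k, v_k]` alone are enough. -/
theorem lie_e_v [CharZero 𝕂] (k i : ι) : ⁅e k, v i⁆ = ((A i k : 𝕂) / 2) • ⁅e k, v k⁆ := by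
  set w : M := (2 : 𝕂) • v i - (A i k : 𝕂) • v k with hw
  have hhw : ⁅h k, w⁆ = 0 := by simp [hw, V.hv]
  have hefw : ⁅e k, ⁅f k, w⁆⁆ = 0 := by
    simp [hw, V.efv, H.diag, smul_smul, mul_comm]
  have heew : ⁅e k, ⁅e k, w⁆⁆ = 0 := by simp [hw, V.eev]
  have hfew : ⁅f k, ⁅e k, w⁆⁆ = 0 := by
    rw [H.lie_f_e (M := M), hefw, if_pos rfl, hhw, sub_zero]
  have h1 : ⁅h k, ⁅e k, w⁆⁆ = 0 := by
    have := H.lie_e_f k ⁅e k, w⁆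
    rwa [hfew, heew, lie_zero, lie_zero, add_zero, eq_comm] at this
  have h2 : ⁅h k, ⁅e k, w⁆⁆ = (2 : 𝕂) • ⁅e k, w⁆ := by
    rw [leibniz_lie, H.he, hhw, H.diag, lie_zero, add_zero, smul_lie]
    norm_num
  have h3 : ⁅e k, w⁆ = 0 := by
    rw [h1] at h2
    exact (smul_eq_zero.1 h2.symm).resolve_left two_ne_zero
  rw [hw, lie_sub, lie_smul, lie_smul, sub_eq_zero] at h3
  rw [div_eq_inv_mul, mul_smul, ← h3, smul_smul, inv_mul_cancel₀ two_ne_zero, one_smul]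

theorem monomial_mem (k : ι) (l : List ι) :
    monomial e v k l ∈ weightSubmodule 𝕂 M A h (monomialWeight k l) := by
  induction l with
  | nil =>
    rw [monomialWeight_nil, ← zero_add (Pi.single k 1)]
    exact lie_mem_weightSubmodule (V.mem_weight_zero k) (H.e_mem k)
  | cons j l ih =>
    rw [monomialWeight_cons, monomial_cons]
    exact lie_mem_weightSubmodule ih (H.e_mem j)

omit V H in
theorem lie_e_raisingSpan (j : ι) {m : M} (hm : m ∈ raisingSpan 𝕂 e v) :
    ⁅e j, m⁆ ∈ raisingSpan 𝕂 e v := by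
  induction hm using Submodule.span_induction with
  | mem m hm =>
    obtain ⟨⟨k, l⟩, rfl⟩ := hm
    exact Submodule.subset_span ⟨(k, j :: l), rfl⟩
  | zero => simp
  | add x y _ _ hx hy => rw [lie_add]; exact add_mem hx hy
  | smul a x _ hx => rw [lie_smul]; exact Submodule.smul_mem _ _ hx

theorem lie_e_span [CharZero 𝕂] (j : ι) {m : M} (hm : m ∈ Submodule.span 𝕂 (Set.range v)) :
    ⁅e j, m⁆ ∈ raisingSpan 𝕂 e v := by
  induction hm using Submodule.span_induction with
  | mem m hm =>
    obtain ⟨i, rfl⟩ := hm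
    rw [V.lie_e_v H]
    exact Submodule.smul_mem _ _ (Submodule.subset_span ⟨(j, []), rfl⟩)
  | zero => simp
  | add x y _ _ hx hy => rw [lie_add]; exact add_mem hx hy
  | smul a x _ hx => rw [lie_smul]; exact Submodule.smul_mem _ _ hx

/-- Commuting `f_j` past the outermost `e_i` produces at most a multiple of a shorter monomial, and
induction on the length ends at `[f_j, [e_k, v_k]]`, a multiple of `v_j`. -/
theorem lie_f_raisingSpan [CharZero 𝕂] (j : ι) {m : M} (hm : m ∈ raisingSpan 𝕂 e v) :
    ⁅f j, m⁆ ∈ raisingSpan 𝕂 e v ⊔ Submodule.span 𝕂 (Set.range v) := by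
  induction hm using Submodule.span_induction with
  | mem m hm =>
    obtain ⟨⟨k, l⟩, rfl⟩ := hm
    dsimp only
    induction l with
    | nil =>
      change ⁅f j, ⁅e k, v k⁆⁆ ∈ _
      rw [(V.symm H).efv]
      refine Submodule.mem_sup_right ?_
      split_ifs
      · exact Submodule.smul_mem _ _ (Submodule.subset_span ⟨j, rfl⟩)
      · exact zero_mem _
    | cons i l ih =>
      rw [monomial_cons, H.lie_f_e (M := M)]
      refine Submodule.mem_sup_left (sub_mem ?_ ?_)
      · obtain ⟨x, hx, y, hy, hxy⟩ := Submodule.mem_sup.1 ih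
        rw [← hxy, lie_add]
        exact add_mem (lie_e_raisingSpan i hx) (V.lie_e_span H i hy)
      · split_ifs
        · rw [V.monomial_mem H k l i]
          exact Submodule.smul_mem _ _ (Submodule.subset_span ⟨(k, l), rfl⟩)
        · exact zero_mem _
  | zero => simp
  | add x y _ _ hx hy => rw [lie_add]; exact add_mem hx hy
  | smul a x _ hx => rw [lie_smul]; exact Submodule.smul_mem _ _ hx

theorem lie_e_mem_triangular [CharZero 𝕂] (j : ι) {m : M}
    (hm : m ∈ raisingSpan 𝕂 e v ⊔ Submodule.span 𝕂 (Set.range v) ⊔ raisingSpan 𝕂 f v) :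
    ⁅e j, m⁆ ∈ raisingSpan 𝕂 e v ⊔ Submodule.span 𝕂 (Set.range v) ⊔ raisingSpan 𝕂 f v := by
  obtain ⟨w, hw, z, hz, rfl⟩ := Submodule.mem_sup.1 hm
  obtain ⟨x, hx, y, hy, rfl⟩ := Submodule.mem_sup.1 hw
  rw [lie_add, lie_add]
  refine add_mem (add_mem ?_ ?_) ?_
  · exact Submodule.mem_sup_left (Submodule.mem_sup_left (lie_e_raisingSpan j hx))
  · exact Submodule.mem_sup_left (Submodule.mem_sup_left (V.lie_e_span H j hy))
  · have := (V.symm H).lie_f_raisingSpan H.symm j hz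
    rw [sup_assoc]
    refine Submodule.mem_sup_right ?_
    rwa [sup_comm]

/-- The sum on the right is stable under all `e_j`, and by the Chevalley involution under all `f_j`;
these generate `L`. -/
theorem lieSpan_eq_triangular [CharZero 𝕂] :
    (LieSubmodule.lieSpan 𝕂 L (Set.range v)).toSubmodule =
      raisingSpan 𝕂 e v ⊔ Submodule.span 𝕂 (Set.range v) ⊔ raisingSpan 𝕂 f v := by
  have hsymm : raisingSpan 𝕂 e v ⊔ Submodule.span 𝕂 (Set.range v) ⊔ raisingSpan 𝕂 f v =
      raisingSpan 𝕂 f v ⊔ Submodule.span 𝕂 (Set.range v) ⊔ raisingSpan 𝕂 e v := by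
    rw [sup_comm, ← sup_assoc, sup_right_comm]
  apply le_antisymm
  · let P : LieSubmodule 𝕂 L M :=
      { raisingSpan 𝕂 e v ⊔ Submodule.span 𝕂 (Set.range v) ⊔ raisingSpan 𝕂 f v with
        lie_mem := fun {x m} hm => lie_mem_of_lieSpan_eq_top H.lieSpan_eq _
          (fun j m hm => V.lie_e_mem_triangular H j hm)
          (fun j m hm => by
            rw [hsymm] at hm ⊢
            exact (V.symm H).lie_e_mem_triangular H.symm j hm) x m hm }
    have : LieSubmodule.lieSpan 𝕂 L (Set.range v) ≤ P := by
      rw [LieSubmodule.lieSpan_le]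
      exact fun m hm => Submodule.mem_sup_left (Submodule.mem_sup_right (Submodule.subset_span hm))
    exact this
  · have hmono : ∀ g : ι → L,
        raisingSpan 𝕂 g v ≤ (LieSubmodule.lieSpan 𝕂 L (Set.range v)).toSubmodule := by
      intro g
      refine Submodule.span_le.2 ?_
      rintro _ ⟨⟨k, l⟩, rfl⟩
      induction l with
      | nil => exact LieSubmodule.lie_mem _ (LieSubmodule.subset_lieSpan ⟨k, rfl⟩)
      | cons j l ih => exact LieSubmodule.lie_mem _ ih
    exact sup_le (sup_le (hmono e) LieSubmodule.submodule_span_le_lieSpan) (hmono f)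

omit V H in
/-- The weight vectors spanning the submodule generated by the `v i`. -/
def spanningVector (e f : ι → L) (v : ι → M) : (ι × List ι) ⊕ ι ⊕ (ι × List ι) → M
  | Sum.inl p => monomial e v p.1 p.2
  | Sum.inr (Sum.inl i) => v i
  | Sum.inr (Sum.inr p) => monomial f v p.1 p.2

omit V H in
/-- The weights of the vectors `spanningVector e f v`. -/
def spanningWeight : (ι × List ι) ⊕ ι ⊕ (ι × List ι) → ι → ℤ
  | Sum.inl p => monomialWeight p.1 p.2
  | Sum.inr (Sum.inl _) => 0
  | Sum.inr (Sum.inr p) => -monomialWeight p.1 p.2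

theorem spanningVector_mem (p : (ι × List ι) ⊕ ι ⊕ (ι × List ι)) :
    spanningVector e f v p ∈ weightSubmodule 𝕂 M A h (spanningWeight p) := by
  rcases p with p | i | p
  · exact V.monomial_mem H p.1 p.2
  · exact V.mem_weight_zero i
  · have := (V.symm H).monomial_mem H.symm p.1 p.2
    rwa [weightSubmodule_neg] at this

theorem lieSpan_eq_span_spanningVector [CharZero 𝕂] :
    (LieSubmodule.lieSpan 𝕂 L (Set.range v)).toSubmodule =
      Submodule.span 𝕂 (Set.range (spanningVector e f v)) := by
  rw [V.lieSpan_eq_triangular H, raisingSpan, raisingSpan, ← Submodule.span_union,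
    ← Submodule.span_union]
  congr 1
  ext m
  simp only [Set.mem_union, Set.mem_range, Sum.exists, spanningVector, or_assoc]

/-- Raising and lowering monomials have nonzero weights, since the coefficient of the initial index
is nonzero; only the `v_i` contribute to weight zero. -/
theorem mem_span_of_lie_h_eq_zero [CharZero 𝕂] {m : M}
    (hm : m ∈ LieSubmodule.lieSpan 𝕂 L (Set.range v)) (h0 : ∀ k, ⁅h k, m⁆ = 0) :
    m ∈ Submodule.span 𝕂 (Set.range v) := by
  have hm' : m ∈ Submodule.span 𝕂 (Set.range (spanningVector e f v)) := by
    rw [← V.lieSpan_eq_span_spanningVector H]; exact hm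
  have h1 := H.mem_span_of_mem_weightSubmodule (V.spanningVector_mem H) hm'
    (mem_weightSubmodule_zero.2 h0)
  refine Submodule.span_mono ?_ h1
  rintro _ ⟨p | i | p, hp, rfl⟩
  · have := monomialWeight_self_pos p.1 p.2
    have hp : monomialWeight p.1 p.2 = 0 := hp
    simp [hp] at this
  · exact ⟨i, rfl⟩
  · have := monomialWeight_self_pos p.1 p.2
    have hp : -monomialWeight p.1 p.2 = 0 := hp
    rw [neg_eq_zero] at hp
    simp [hp] at this

/-- The weights of the submodule generated by the `v i` do not have coefficients of both signs. -/
theorem eq_zero_of_mixed_weight [CharZero 𝕂] {m : M}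
    (hm : m ∈ LieSubmodule.lieSpan 𝕂 L (Set.range v)) {c : ι → ℤ}
    (hc : m ∈ weightSubmodule 𝕂 M A h c) {i j : ι} (hi : c i < 0) (hj : 0 < c j) : m = 0 := by
  have hm' : m ∈ Submodule.span 𝕂 (Set.range (spanningVector e f v)) := by
    rw [← V.lieSpan_eq_span_spanningVector H]; exact hm
  have h1 := H.mem_span_of_mem_weightSubmodule (V.spanningVector_mem H) hm' hc
  have h2 : spanningVector e f v '' {p | spanningWeight p = c} = ∅ := by
    rw [Set.image_eq_empty, Set.eq_empty_iff_forall_notMem]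
    rintro (p | k | p) rfl
    · exact absurd (monomialWeight_nonneg p.1 p.2 i) (not_le.2 hi)
    · exact absurd hi (lt_irrefl _)
    · have := monomialWeight_nonneg p.1 p.2 j
      simp only [spanningWeight, Pi.neg_apply, Pi.zero_apply] at hj this
      omega
  simpa [h2] using h1

end IsCartanLike

end Triangular

/-! ### Finite type, local nilpotency and lowest weight vectors. -/

section Finite

variable {𝕂 L M ι : Type*} [Field 𝕂] [LieRing L] [LieAlgebra 𝕂 L]
  [AddCommGroup M] [Module 𝕂 M] [LieRingModule L M] [LieModule 𝕂 L M]
  [DecidableEq ι] [Fintype ι] {A : Matrix ι ι ℤ} {e f h : ι → L} {v : ι → M}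

/-- In a representation of `sl₂`, a lowest weight vector on which `e` acts nilpotently has
a weight in `-ℕ`. -/
theorem exists_nat_of_lowest_weight [CharZero 𝕂] {x y z : L} (hxy : ⁅x, y⁆ = z)
    (hzx : ⁅z, x⁆ = (2 : 𝕂) • x) {m : M} (hm : m ≠ 0) {a : 𝕂} (hz : ⁅z, m⁆ = a • m)
    (hy : ⁅y, m⁆ = 0) {N : ℕ} (hN : (LieModule.toEnd 𝕂 L M x ^ N) m = 0) :
    ∃ n : ℕ, a = -(n : 𝕂) := by
  let p : ℕ → M := fun n => (LieModule.toEnd 𝕂 L M x ^ n) m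
  have hp : ∀ n, p (n + 1) = ⁅x, p n⁆ := fun n => by
    simp only [p]
    rw [pow_succ', Module.End.mul_apply, LieModule.toEnd_apply_apply]
  have hzp : ∀ n, ⁅z, p n⁆ = (a + 2 * n) • p n := by
    intro n
    induction n with
    | zero => simpa [p] using hz
    | succ n ih =>
      rw [hp, leibniz_lie, hzx, ih, smul_lie, lie_smul, ← add_smul]
      congr 1
      push_cast
      ring
  -- The standard `sl₂` computation. If `a` is not in `-ℕ`, the factor `(n + 1)(a + n)` never
  -- vanishes, so no `p n` can vanish, against nilpotency.
  have hyp : ∀ n, ⁅y, p (n + 1)⁆ = (-((n + 1) * (a + n)) : 𝕂) • p n := by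
    intro n
    induction n with
    | zero =>
      rw [hp, leibniz_lie, ← lie_skew, hxy, neg_lie, hzp]
      simp [p, hy]
    | succ n ih =>
      rw [hp, leibniz_lie, ← lie_skew, hxy, neg_lie, hzp, ih, lie_smul, ← hp, ← neg_smul, ← add_smul]
      congr 1
      push_cast
      ring
  by_contra! hne
  have hpn : ∀ n, p n ≠ 0 := by
    intro n
    induction n with
    | zero => simpa [p] using hm
    | succ n ih =>
      intro h0
      have h1 := hyp n
      rw [h0, lie_zero, eq_comm, smul_eq_zero, or_iff_left ih, neg_eq_zero, mul_eq_zero] at h1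
      rcases h1 with h1 | h1
      · exact Nat.cast_add_one_ne_zero n h1
      · exact hne n (eq_neg_of_add_eq_zero_left h1)
  exact hpn N hN

/-- The bracket of an ad-nilpotent element with a vector on which `x` acts nilpotently. -/
theorem toEnd_pow_lie_eq_zero {x : L} (a b : ℕ) {y : L} {m : M}
    (hy : (LieAlgebra.ad 𝕂 L x ^ a) y = 0) (hm : (LieModule.toEnd 𝕂 L M x ^ b) m = 0) :
    (LieModule.toEnd 𝕂 L M x ^ (a + b)) ⁅y, m⁆ = 0 := by
  -- By the Leibniz rule each application of `x` lowers either `a` or `b` by one. The exponent `a +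
  -- b` is not sharp, which leaves only the case `a = b = 0` as base.
  induction hn : a + b generalizing a b y m with
  | zero =>
    obtain ⟨rfl, rfl⟩ : a = 0 ∧ b = 0 := by omega
    have : y = 0 := hy
    simp [this]
  | succ n ih =>
    rw [pow_succ, Module.End.mul_apply, LieModule.toEnd_apply_apply, leibniz_lie, map_add]
    have h1 : (LieModule.toEnd 𝕂 L M x ^ n) ⁅⁅x, y⁆, m⁆ = 0 := by
      rcases a with _ | a
      · have : y = 0 := hy
        simp [this]
      · refine ih a b ?_ hm (by omega)
        rwa [pow_succ, Module.End.mul_apply] at hy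
    have h2 : (LieModule.toEnd 𝕂 L M x ^ n) ⁅y, ⁅x, m⁆⁆ = 0 := by
      rcases b with _ | b
      · have : m = 0 := hm
        simp [this]
      · refine ih a b hy ?_ (by omega)
        rwa [pow_succ, Module.End.mul_apply] at hm
    rw [h1, h2, add_zero]

namespace IsChevalley

variable (H : IsChevalley 𝕂 A e f h)
include H

theorem e_ne_zero {i : ι} (hi : h i ≠ 0) : e i ≠ 0 := by
  intro h0
  have := H.ef i i
  rw [h0, zero_lie, if_pos rfl] at this
  exact hi this.symm

/-- The elements killed by a power of `ad (e i)` form the Engel subalgebra, so checking generators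
suffices: the Serre relations for the `e j`, and the cube of `ad (e i)` for the `f j`. -/
theorem ad_nilpotent (i : ι) (y : L) : ∃ n, (LieAlgebra.ad 𝕂 L (e i) ^ n) y = 0 := by
  rw [← LieSubalgebra.mem_engel_iff]
  suffices hle : LieSubalgebra.lieSpan 𝕂 L (Set.range e ∪ Set.range f) ≤
      LieSubalgebra.engel 𝕂 (e i) from hle (H.lieSpan_eq ▸ trivial)
  rw [LieSubalgebra.lieSpan_le]
  rintro _ (⟨j, rfl⟩ | ⟨j, rfl⟩)
  · exact (LieSubalgebra.mem_engel_iff _ _ _).2 (H.serreE i j)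
  · refine (LieSubalgebra.mem_engel_iff _ _ _).2 ⟨3, ?_⟩
    simp only [pow_succ, pow_zero, one_mul, Module.End.mul_apply, LieAlgebra.ad_apply, H.ef]
    split_ifs with hij
    · rw [← lie_skew (e i) (h i), H.he]; simp
    · simp

/-- Since `A k k = 2` is invertible, `e k` and `f k` are multiples of their brackets with `h k`.
Hence homomorphisms out of the adjoint module are determined by their values on the `h k`. -/
theorem lieSpan_h_eq_top [CharZero 𝕂] : LieSubmodule.lieSpan 𝕂 L (Set.range h) = ⊤ := by
  set I : LieIdeal 𝕂 L := LieSubmodule.lieSpan 𝕂 L (Set.range h)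
  have hh : ∀ k, h k ∈ I := fun k => LieSubmodule.subset_lieSpan ⟨k, rfl⟩
  have he : ∀ k, e k ∈ I := by
    intro k
    have h1 : ⁅e k, h k⁆ ∈ I := I.lie_mem (hh k)
    rw [← lie_skew, H.he, H.diag] at h1
    have h2 := I.smul_mem (-(2 : 𝕂)⁻¹) h1
    simpa using h2
  have hf : ∀ k, f k ∈ I := by
    intro k
    have h1 : ⁅f k, h k⁆ ∈ I := I.lie_mem (hh k)
    rw [← lie_skew, H.hf, H.diag] at h1
    have h2 := I.smul_mem ((2 : 𝕂)⁻¹) h1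
    simpa using h2
  have hle : LieSubalgebra.lieSpan 𝕂 L (Set.range e ∪ Set.range f) ≤ I.toLieSubalgebra 𝕂 L := by
    rw [LieSubalgebra.lieSpan_le]
    rintro _ (⟨j, rfl⟩ | ⟨j, rfl⟩)
    · exact he j
    · exact hf j
  rw [eq_top_iff]
  intro x _
  exact hle (H.lieSpan_eq ▸ trivial)

theorem span_spanningVector_eq_top [CharZero 𝕂] :
    Submodule.span 𝕂 (Set.range (IsCartanLike.spanningVector e f h)) = ⊤ := by
  rw [← H.isCartanLike.lieSpan_eq_span_spanningVector H, H.lieSpan_h_eq_top]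
  rfl

theorem exists_weight_basis [CharZero 𝕂] [FiniteDimensional 𝕂 L] :
    ∃ (n : ℕ) (b : Module.Basis (Fin n) 𝕂 L) (d : Fin n → ι → ℤ),
      ∀ p, b p ∈ weightSubmodule 𝕂 L A h (d p) := by
  have hs : ⊤ ≤ Submodule.span 𝕂 (Set.range (IsCartanLike.spanningVector e f h)) :=
    H.span_spanningVector_eq_top.ge
  let b := Module.Basis.ofSpan hs
  have : Finite _ := Module.Finite.finite_basis b
  obtain ⟨n, ⟨eq⟩⟩ := Finite.exists_equiv_fin
    ((linearIndepOn_empty 𝕂 id).extend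
      (Set.empty_subset (Set.range (IsCartanLike.spanningVector e f h))))
  have hb : ∀ p, ∃ d, (b.reindex eq) p ∈ weightSubmodule 𝕂 L A h d := by
    intro p
    rw [Module.Basis.reindex_apply]
    obtain ⟨q, hq⟩ := Module.Basis.ofSpan_subset hs (Set.mem_range_self (eq.symm p))
    exact ⟨IsCartanLike.spanningWeight q, hq ▸ H.isCartanLike.spanningVector_mem H q⟩
  choose d hd using hb
  exact ⟨n, b.reindex eq, d, hd⟩

/-- In a weight basis the `ad (h i)` are diagonal with integer eigenvalues. The Gram matrix of the
`h i` is thus an integral sum of squares type matrix, so positivity can be used although `𝕂` is not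
ordered. -/
theorem killingForm_h [FiniteDimensional 𝕂 L] {n : ℕ} (b : Module.Basis (Fin n) 𝕂 L)
    (d : Fin n → ι → ℤ) (hd : ∀ p, b p ∈ weightSubmodule 𝕂 L A h (d p)) (i j : ι) :
    killingForm 𝕂 L (h i) (h j) = ((∑ p, A.mulVec (d p) i * A.mulVec (d p) j : ℤ) : 𝕂) := by
  rw [killingForm_apply_apply, LinearMap.trace_eq_matrix_trace 𝕂 b, Matrix.trace]
  push_cast
  refine Finset.sum_congr rfl fun p _ => ?_
  rw [Matrix.diag_apply, LinearMap.toMatrix_apply, LinearMap.comp_apply, LieAlgebra.ad_apply,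
    LieAlgebra.ad_apply, hd p j, lie_smul, hd p i, smul_smul]
  simp [mul_comm]

/-- The matrix of a finite-dimensional algebra is of finite type. -/
theorem eq_zero_of_mulVec_nonpos [CharZero 𝕂] [FiniteDimensional 𝕂 L] (hne : ∀ i, h i ≠ 0)
    {c : ι → ℤ} (hc : 0 ≤ c) (hA : A.mulVec c ≤ 0) : c = 0 := by
  obtain ⟨n, b, d, hd⟩ := H.exists_weight_basis
  set χ : Fin n → ι → ℤ := fun p => A.mulVec (d p) with hχ
  let t : ι → ι → ℤ := fun i j => ∑ p, χ p i * χ p j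
  have ht : ∀ i j, killingForm 𝕂 L (h i) (h j) = (t i j : 𝕂) := H.killingForm_h b d hd
  -- Definiteness: a rational combination of the `h l` on which all weights vanish acts as zero on
  -- `L`, in particular on each `e k ≠ 0`, and invertibility of `A` makes its coefficients zero.
  have hact : ∀ (x : ι → ℚ), (∀ p, ∑ l, x l * χ p l = 0) → x = 0 := by
    intro x hx
    have h1 : ∀ y : L, ⁅∑ l, (x l : 𝕂) • h l, y⁆ = 0 := by
      intro y
      induction b.mem_span y using Submodule.span_induction with
      | mem y hy =>
        obtain ⟨p, rfl⟩ := hy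
        rw [sum_lie]
        have h2 : ∀ l, ⁅(x l : 𝕂) • h l, b p⁆ = ((x l * χ p l : ℚ) : 𝕂) • b p := by
          intro l
          rw [smul_lie, hd p l, smul_smul]
          push_cast
          rfl
        simp only [h2]
        rw [← Finset.sum_smul, ← Rat.cast_sum, hx p, Rat.cast_zero, zero_smul]
      | zero => simp
      | add y z _ _ hy hz => rw [lie_add, hy, hz, add_zero]
      | smul a y _ hy => rw [lie_smul, hy, smul_zero]
    have h3 : (A.map (Int.cast : ℤ → ℚ)).transpose.mulVec x = 0 := by
      funext k
      have h4 := h1 (e k)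
      rw [sum_lie] at h4
      have h5 : ∀ l, ⁅(x l : 𝕂) • h l, e k⁆ = ((x l * A l k : ℚ) : 𝕂) • e k := by
        intro l
        rw [smul_lie, H.he, smul_smul]
        push_cast
        rfl
      simp only [h5] at h4
      rw [← Finset.sum_smul, smul_eq_zero, or_iff_left (H.e_ne_zero (hne k)), ← Rat.cast_sum,
        Rat.cast_eq_zero] at h4
      rw [Pi.zero_apply, ← h4]
      simp [Matrix.mulVec, dotProduct, mul_comm]
    refine Matrix.eq_zero_of_mulVec_eq_zero ?_ h3
    rw [Matrix.det_transpose]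
    have h4 := Int.cast_det (R := ℚ) A
    rw [← h4]
    exact_mod_cast H.det_ne
  -- Invariance of the Killing form, applied to `h j = [e j, f j]`, shows that it symmetrises `A`.
  have htA : ∀ i j, 2 * t i j = A i j * t j j := by
    have h1 : ∀ i j, killingForm 𝕂 L (h i) (h j) = (A i j : 𝕂) * killingForm 𝕂 L (e j) (f j) := by
      intro i j
      have h2 : h j = ⁅e j, f j⁆ := by rw [H.ef, if_pos rfl]
      rw [h2, killingForm, ← LieModule.traceForm_apply_lie_apply, H.he]
      simp
    intro i j
    have h3 := h1 i j
    have h4 := h1 j j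
    rw [ht, H.diag] at h4
    rw [ht] at h3
    have h5 : ((2 * t i j : ℤ) : 𝕂) = ((A i j * t j j : ℤ) : 𝕂) := by
      push_cast
      rw [h3, h4]
      push_cast
      ring
    exact_mod_cast h5
  have htpos : ∀ j, 0 < t j j := by
    intro j
    refine lt_of_le_of_ne (Finset.sum_nonneg fun p _ => mul_self_nonneg _) fun h0 => ?_
    have h1 : ∀ p, χ p j = 0 := by
      intro p
      have := (Finset.sum_eq_zero_iff_of_nonneg fun p _ => mul_self_nonneg (χ p j)).1 h0.symm p
        (Finset.mem_univ p)
      exact mul_self_eq_zero.1 this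
    have h2 := congrFun (hact (Pi.single j 1) fun p => by simp [Pi.single_apply, h1]) j
    simp at h2
  -- Dividing by `t l l` turns the quadratic form of `t` at `x` into half the sum of the `x l * (A
  -- c) l`, which is nonpositive by assumption; definiteness then forces `x = 0`.
  let x : ι → ℚ := fun l => c l / t l l
  have htq : ∀ j, (0 : ℚ) < t j j := fun j => by exact_mod_cast htpos j
  have hsum : ∑ p, (∑ l, x l * χ p l) ^ 2 ≤ 0 := by
    have h1 : ∑ p, (∑ l, x l * χ p l) ^ 2 = ∑ l, ∑ k, x l * (x k * (t l k : ℚ)) := by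
      have h3 : ∀ p, (∑ l, x l * χ p l) ^ 2 =
          ∑ l, ∑ k, x l * (x k * ((χ p l : ℚ) * χ p k)) := by
        intro p
        rw [sq, Finset.sum_mul_sum]
        exact Finset.sum_congr rfl fun l _ => Finset.sum_congr rfl fun k _ => by ring
      simp only [h3]
      rw [Finset.sum_comm]
      refine Finset.sum_congr rfl fun l _ => ?_
      rw [Finset.sum_comm]
      refine Finset.sum_congr rfl fun k _ => ?_
      simp only [t, Int.cast_sum, Int.cast_mul, Finset.mul_sum]
    have h2 : ∀ l k, x k * (t l k : ℚ) = (A l k * c k : ℤ) / 2 := by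
      intro l k
      have h3 : (2 : ℚ) * t l k = A l k * t k k := by exact_mod_cast htA l k
      have h4 : (t l k : ℚ) = A l k * t k k / 2 := by linarith
      simp only [x]
      rw [h4]
      have := (htq k).ne'
      field_simp
      push_cast
      ring
    rw [h1]
    refine Finset.sum_nonpos fun l _ => ?_
    rw [← Finset.mul_sum]
    refine mul_nonpos_of_nonneg_of_nonpos (div_nonneg (by exact_mod_cast hc l) (htq l).le) ?_
    simp only [h2]
    rw [← Finset.sum_div, ← Int.cast_sum]
    have h5 : ∑ k, A l k * c k ≤ 0 := hA l
    have h6 : ((∑ k, A l k * c k : ℤ) : ℚ) ≤ 0 := by exact_mod_cast h5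
    linarith
  have hx : x = 0 := by
    refine hact x fun p => ?_
    have h1 := (Finset.sum_eq_zero_iff_of_nonneg fun p _ => sq_nonneg (∑ l, x l * (χ p l : ℚ))).1
      (le_antisymm hsum (Finset.sum_nonneg fun p _ => sq_nonneg _)) p (Finset.mem_univ p)
    exact pow_eq_zero_iff two_ne_zero |>.1 h1
  funext l
  have h1 := congrFun hx l
  simp only [x, Pi.zero_apply, div_eq_zero_iff, or_iff_left (htq l).ne'] at h1
  exact_mod_cast h1

end IsChevalley

namespace IsCartanLike

variable (V : IsCartanLike 𝕂 A e f h v) (H : IsChevalley 𝕂 A e f h)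
include V H

/-- Each `v i` is killed by the square of `e k`, and local nilpotency passes to brackets with
elements of `L` because `ad (e k)` is itself locally nilpotent. -/
theorem toEnd_e_nilpotent (k : ι) {m : M} (hm : m ∈ LieSubmodule.lieSpan 𝕂 L (Set.range v)) :
    ∃ n, (LieModule.toEnd 𝕂 L M (e k) ^ n) m = 0 := by
  induction hm using LieSubmodule.lieSpan_induction with
  | mem m hm =>
    obtain ⟨i, rfl⟩ := hm
    exact ⟨2, by simp [pow_succ, V.eev]⟩
  | zero => exact ⟨0, by simp⟩
  | add x y _ _ hx hy =>
    obtain ⟨a, ha⟩ := hx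
    obtain ⟨b, hb⟩ := hy
    refine ⟨a + b, ?_⟩
    rw [map_add, pow_add, Module.End.mul_apply, Module.End.mul_apply, hb, map_zero, add_zero,
      ← Module.End.mul_apply, ← pow_add, add_comm, pow_add, Module.End.mul_apply, ha, map_zero]
  | smul a x _ hx =>
    obtain ⟨n, hn⟩ := hx
    exact ⟨n, by rw [map_smul, hn, smul_zero]⟩
  | lie x y _ hy =>
    obtain ⟨a, ha⟩ := H.ad_nilpotent k x
    obtain ⟨b, hb⟩ := hy
    exact ⟨a + b, toEnd_pow_lie_eq_zero a b ha hb⟩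

variable [CharZero 𝕂] [FiniteDimensional 𝕂 L]

/-- Induction on the height of `c`. In height zero, `m` lies in the span of the `v i`. Otherwise
each `f l` kills `m`: `[f l, m]` has smaller height if `c l > 0`, and a weight of mixed signs if `c
l = 0`. A nonzero `m` would be a lowest weight vector, so `A c ≤ 0`, contradicting finite type. -/
theorem eq_zero_of_nonneg_weight (hne : ∀ i, h i ≠ 0) {N : LieSubmodule 𝕂 L M}
    (hN : N ≤ LieSubmodule.lieSpan 𝕂 L (Set.range v))
    (hdisj : Disjoint N.toSubmodule (Submodule.span 𝕂 (Set.range v)))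
    {c : ι → ℤ} (hc : 0 ≤ c) {m : M} (hm : m ∈ N) (hmc : m ∈ weightSubmodule 𝕂 M A h c) :
    m = 0 := by
  induction hs : (∑ k, c k).toNat using Nat.strong_induction_on generalizing c m with
  | _ s ih =>
  by_cases hc0 : c = 0
  · subst hc0
    exact Submodule.disjoint_def.1 hdisj m hm
      (V.mem_span_of_lie_h_eq_zero H (hN hm) (mem_weightSubmodule_zero.1 hmc))
  · have hf : ∀ l, ⁅f l, m⁆ = 0 := by
      intro l
      have hw := lie_mem_weightSubmodule hmc (H.f_mem l)
      have hmem : ⁅f l, m⁆ ∈ N := N.lie_mem hm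
      rcases (hc l).eq_or_lt with hl | hl
      · obtain ⟨j, hj⟩ := Function.ne_iff.1 hc0
        have hjl : j ≠ l := by
          rintro rfl
          exact hj hl.symm
        refine V.eq_zero_of_mixed_weight H (hN hmem) hw (i := l) (j := j) ?_ ?_
        · have : c l = 0 := hl.symm
          simp [this]
        · simpa [hjl] using lt_of_le_of_ne (hc j) (Ne.symm hj)
      · have hl' : 0 < c l := hl
        have hsum : ∑ k, (c + -Pi.single l 1 : ι → ℤ) k = ∑ k, c k - 1 := by
          simp [Finset.sum_add_distrib, sub_eq_add_neg]
        have hpos : 0 < ∑ k, c k :=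
          lt_of_lt_of_le hl' (Finset.single_le_sum (fun k _ => hc k) (Finset.mem_univ l))
        refine ih _ ?_ ?_ hmem hw rfl
        · rw [hsum, ← hs]
          omega
        · intro k
          by_cases hk : k = l
          · subst hk
            simp
            omega
          · simpa [hk] using hc k
    by_contra hm0
    refine hc0 (H.eq_zero_of_mulVec_nonpos hne hc fun l => ?_)
    obtain ⟨N', hN'⟩ := V.toEnd_e_nilpotent H l (hN hm)
    obtain ⟨n, hn⟩ := exists_nat_of_lowest_weight (x := e l) (y := f l) (z := h l)
      (by rw [H.ef, if_pos rfl]) (by rw [H.he, H.diag]; norm_num) hm0 (hmc l) (hf l) hN'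
    have h1 : A.mulVec c l = -(n : ℤ) := by exact_mod_cast hn
    simp [h1]

/-- A submodule of the module generated by the `v i` which does not meet their span is zero. -/
theorem eq_bot_of_disjoint_span (hne : ∀ i, h i ≠ 0) {N : LieSubmodule 𝕂 L M}
    (hN : N ≤ LieSubmodule.lieSpan 𝕂 L (Set.range v))
    (hdisj : Disjoint N.toSubmodule (Submodule.span 𝕂 (Set.range v))) : N = ⊥ := by
  rw [← LieSubmodule.toSubmodule_inj, LieSubmodule.bot_toSubmodule]
  have hN' : N.toSubmodule ≤ Submodule.span 𝕂 (Set.range (spanningVector e f v)) := by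
    rw [← V.lieSpan_eq_span_spanningVector H]
    exact hN
  refine H.eq_bot_of_weightSubmodule_disjoint (V.spanningVector_mem H)
    (fun k m hm => N.lie_mem hm) hN' ?_
  rintro (p | i | p) n hn hw
  · exact V.eq_zero_of_nonneg_weight H hne hN hdisj (monomialWeight_nonneg _ _) hn hw
  · exact V.eq_zero_of_nonneg_weight H hne hN hdisj le_rfl hn hw
  · refine (V.symm H).eq_zero_of_nonneg_weight H.symm (fun i => neg_ne_zero.2 (hne i)) hN hdisj
      (monomialWeight_nonneg p.1 p.2) hn ?_
    rw [weightSubmodule_neg]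
    exact hw

end IsCartanLike

end Finite

/-! ### Construction of the homomorphism through its graph. -/

section Graph

variable {𝕂 L M M' ι : Type*} [Field 𝕂] [LieRing L] [LieAlgebra 𝕂 L]
  [AddCommGroup M] [Module 𝕂 M] [LieRingModule L M] [LieModule 𝕂 L M]
  [AddCommGroup M'] [Module 𝕂 M'] [LieRingModule L M'] [LieModule 𝕂 L M']
  [DecidableEq ι] [Fintype ι] {A : Matrix ι ι ℤ} {e f h : ι → L} {v : ι → M}

/-- The direct product of two Lie modules. -/
abbrev prodLieRingModule : LieRingModule L (M × M') where
  bracket x m := (⁅x, m.1⁆, ⁅x, m.2⁆)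
  add_lie x y m := Prod.ext (add_lie x y m.1) (add_lie x y m.2)
  lie_add x m n := Prod.ext (lie_add x m.1 n.1) (lie_add x m.2 n.2)
  leibniz_lie x y m := Prod.ext (leibniz_lie x y m.1) (leibniz_lie x y m.2)

attribute [local instance] prodLieRingModule

theorem prod_lie_mk (x : L) (m : M) (n : M') : ⁅x, (m, n)⁆ = (⁅x, m⁆, ⁅x, n⁆) := rfl

theorem prodLieModule : LieModule 𝕂 L (M × M') where
  smul_lie a x m := Prod.ext (smul_lie a x m.1) (smul_lie a x m.2)
  lie_smul a x m := Prod.ext (lie_smul a x m.1) (lie_smul a x m.2)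

attribute [local instance] prodLieModule

/-- The relations hold componentwise, so the structure results apply to the submodule generated by
the pairs. -/
theorem IsCartanLike.prod {u : ι → M'} (V : IsCartanLike 𝕂 A e f h v)
    (U : IsCartanLike 𝕂 A e f h u) : IsCartanLike 𝕂 A e f h fun i => (v i, u i) where
  hv i j := by rw [prod_lie_mk, V.hv, U.hv]; rfl
  efv k l i := by
    rw [prod_lie_mk, prod_lie_mk, V.efv, U.efv]
    split_ifs <;> simp
  eev k i := by rw [prod_lie_mk, prod_lie_mk, V.eev, U.eev]; rfl
  ffv k i := by rw [prod_lie_mk, prod_lie_mk, V.ffv, U.ffv]; rfl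

theorem lieHom_ext_of_lieSpan_eq_top {s : Set L} (hs : LieSubmodule.lieSpan 𝕂 L s = ⊤)
    {φ ψ : L →ₗ⁅𝕂, L⁆ M} (hφ : ∀ x ∈ s, φ x = ψ x) : φ = ψ := by
  ext x
  have hx : x ∈ LieSubmodule.lieSpan 𝕂 L s := hs ▸ LieSubmodule.mem_top x
  induction hx using LieSubmodule.lieSpan_induction with
  | mem x hx => exact hφ x hx
  | zero => simp
  | add x y _ _ hx hy => rw [map_add, map_add, hx, hy]
  | smul a x _ hx => rw [map_smul, map_smul, hx]
  | lie x y _ hy => rw [LieModuleHom.map_lie, LieModuleHom.map_lie, hy]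

/-- If the `v i` satisfy the relations of the `h i`, then there is a module homomorphism from the
adjoint module sending `h i` to `v i`. -/
theorem IsCartanLike.exists_lieModuleHom [CharZero 𝕂] [FiniteDimensional 𝕂 L]
    (V : IsCartanLike 𝕂 A e f h v) (H : IsChevalley 𝕂 A e f h) (hli : LinearIndependent 𝕂 h) :
    ∃ s : L →ₗ⁅𝕂, L⁆ M, ∀ i, s (h i) = v i := by
  have U := H.isCartanLike.prod V
  set u : ι → L × M := fun i => (h i, v i) with hu
  set G : LieSubmodule 𝕂 L (L × M) := LieSubmodule.lieSpan 𝕂 L (Set.range u) with hG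
  let π : G →ₗ⁅𝕂, L⁆ L :=
    { LinearMap.fst 𝕂 L M ∘ₗ G.toSubmodule.subtype with map_lie' := rfl }
  -- `N` measures the failure of `G` to be single-valued over `L`.
  let N : LieSubmodule 𝕂 L (L × M) :=
    { G.toSubmodule ⊓ LinearMap.ker (LinearMap.fst 𝕂 L M) with
      lie_mem := fun {x m} hm => ⟨G.lie_mem hm.1, by
        have h1 : m.1 = 0 := hm.2
        change ⁅x, m.1⁆ = 0
        rw [h1, lie_zero]⟩ }
  have hN : N = ⊥ := by
    refine U.eq_bot_of_disjoint_span H (fun i => hli.ne_zero i) (fun m hm => hm.1) ?_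
    rw [Submodule.disjoint_def]
    intro m hm hmu
    obtain ⟨c, rfl⟩ := (Submodule.mem_span_range_iff_exists_fun 𝕂).1 hmu
    have h1 : ∑ i, c i • h i = 0 := by
      have h2 : (∑ i, c i • u i).1 = 0 := hm.2
      simpa [Prod.fst_sum, hu] using h2
    have h3 := Fintype.linearIndependent_iff.1 hli c h1
    simp [h3]
  have hinj : Function.Injective π := by
    rw [injective_iff_map_eq_zero]
    intro x hx
    have h1 : (x : L × M) ∈ N := ⟨x.2, hx⟩
    rw [hN, LieSubmodule.mem_bot] at h1
    exact Subtype.ext h1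
  -- The image contains all `h i`, which generate the adjoint module; so `G` is a graph over all of
  -- `L`.
  have hsurj : Function.Surjective π := by
    rw [← LieModuleHom.range_eq_top, eq_top_iff, ← H.lieSpan_h_eq_top, LieSubmodule.lieSpan_le]
    rintro _ ⟨i, rfl⟩
    exact ⟨⟨u i, LieSubmodule.subset_lieSpan ⟨i, rfl⟩⟩, rfl⟩
  let E : G ≃ₗ[𝕂] L := LinearEquiv.ofBijective (π : G →ₗ[𝕂] L) ⟨hinj, hsurj⟩
  have hE : ∀ g, E g = π g := fun _ => rfl
  refine ⟨{ LinearMap.snd 𝕂 L M ∘ₗ G.toSubmodule.subtype ∘ₗ E.symm.toLinearMap with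
    map_lie' := ?_ }, ?_⟩
  · intro x y
    obtain ⟨g, rfl⟩ := E.surjective y
    have h1 : ⁅x, E g⁆ = E ⁅x, g⁆ := by rw [hE, hE, LieModuleHom.map_lie]
    simp only [AddHom.toFun_eq_coe, LinearMap.coe_toAddHom, LinearMap.comp_apply,
      LinearEquiv.coe_coe, h1, LinearEquiv.symm_apply_apply]
    rfl
  · intro i
    let g : G := ⟨u i, LieSubmodule.subset_lieSpan ⟨i, rfl⟩⟩
    have h1 : E.symm (h i) = g := by
      rw [LinearEquiv.symm_apply_eq]
      rfl
    change ((E.symm (h i) : G) : L × M).2 = v i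
    rw [h1]

end Graph

/-! ### Ideals acting trivially lie in the kernel. -/

section Kernel

variable {𝕂 L M ι : Type*} [Field 𝕂] [LieRing L] [LieAlgebra 𝕂 L]
  [AddCommGroup M] [Module 𝕂 M] [LieRingModule L M] [LieModule 𝕂 L M]
  [DecidableEq ι] [Fintype ι] {A : Matrix ι ι ℤ} {e f h : ι → L} {v : ι → M}

/-- For `x` in `I` the vector `s x` has weight zero, so it equals `s y` for a combination `y` of the
`h k`, again in `I`. The indices with `e k ∈ I` are decoupled in `A` from the others, and
invertibility of `A` shows that only these occur in `y`. For them `s (h k) = [e k, s (f k)] = 0`. -/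
theorem IsCartanLike.ideal_le_ker [CharZero 𝕂] (V : IsCartanLike 𝕂 A e f h v)
    (H : IsChevalley 𝕂 A e f h) (hA : ∀ i j, A i j = 0 → A j i = 0)
    (s : L →ₗ⁅𝕂, L⁆ M) (hs : ∀ i, s (h i) = v i) (I : LieIdeal 𝕂 L)
    (hI : ∀ x ∈ I, ∀ m : M, ⁅x, m⁆ = 0) (hker : ∀ x, s x = 0 → x ∈ I) :
    ∀ x ∈ I, s x = 0 := by
  classical
  have hrange : ∀ y, s y ∈ LieSubmodule.lieSpan 𝕂 L (Set.range v) := by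
    intro y
    have hy : y ∈ LieSubmodule.lieSpan 𝕂 L (Set.range h) := by
      rw [H.lieSpan_h_eq_top]; trivial
    have hle : LieSubmodule.lieSpan 𝕂 L (Set.range h) ≤
        (LieSubmodule.lieSpan 𝕂 L (Set.range v)).comap s := by
      rw [LieSubmodule.lieSpan_le]
      rintro _ ⟨i, rfl⟩
      exact LieSubmodule.subset_lieSpan ⟨i, (hs i).symm⟩
    exact hle hy
  intro x hx
  have h0 : ∀ k, ⁅h k, s x⁆ = 0 := by
    intro k
    rw [← LieModuleHom.map_lie, ← lie_skew, map_neg, LieModuleHom.map_lie, hI x hx, neg_zero]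
  obtain ⟨c, hc⟩ := (Submodule.mem_span_range_iff_exists_fun 𝕂).1
    (V.mem_span_of_lie_h_eq_zero H (hrange x) h0)
  set y : L := ∑ k, c k • h k with hy
  have hsy : s x = s y := by
    rw [← hc, hy, map_sum]
    simp [hs]
  have hyI : y ∈ I := by
    have h1 : y - x ∈ I := hker _ (by rw [map_sub, hsy, sub_self])
    simpa using I.add_mem h1 hx
  have hhI : ∀ k, e k ∈ I → h k ∈ I := by
    intro k hk
    have h1 := H.ef k k
    rw [if_pos rfl] at h1
    rw [← h1, ← lie_skew]
    exact I.neg_mem (I.lie_mem hk)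
  have hsmul : ∀ (a : 𝕂) k, e k ∉ I → a • e k ∈ I → a = 0 := by
    intro a k hk ha
    by_contra hne
    exact hk (by simpa [smul_smul, hne] using I.smul_mem a⁻¹ ha)
  have hAI : ∀ k l, e k ∈ I → e l ∉ I → A k l = 0 := by
    intro k l hk hl
    have h1 : ⁅e l, h k⁆ ∈ I := I.lie_mem (hhI k hk)
    rw [← lie_skew, H.he, ← neg_smul] at h1
    have h2 := hsmul _ l hl h1
    rw [neg_eq_zero] at h2
    exact_mod_cast h2
  let c' : ι → 𝕂 := fun k => if e k ∈ I then 0 else c k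
  -- For `e l ∉ I`, the bracket `[e l, y] ∈ I` is a multiple of `e l`, so its coefficient vanishes.
  -- For `e l ∈ I`, the remaining entries of `A` vanish by `hAI` and the symmetry `hA` of the zero
  -- pattern.
  have hc' : (A.map (Int.cast : ℤ → 𝕂)).transpose.mulVec c' = 0 := by
    funext l
    simp only [Matrix.mulVec, dotProduct, Matrix.transpose_apply, Matrix.map_apply, Pi.zero_apply]
    by_cases hl : e l ∈ I
    · refine Finset.sum_eq_zero fun k _ => ?_
      by_cases hk : e k ∈ I
      · simp [c', hk]
      · simp [hA l k (hAI l k hl hk)]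
    · have h1 : ⁅e l, y⁆ ∈ I := I.lie_mem hyI
      have h2 : ⁅e l, y⁆ = (-∑ k, (A k l : 𝕂) * c k) • e l := by
        rw [← lie_skew, hy, sum_lie, neg_smul, Finset.sum_smul]
        congr 1
        refine Finset.sum_congr rfl fun k _ => ?_
        rw [smul_lie, H.he, smul_smul, mul_comm]
      rw [h2] at h1
      have h3 := neg_eq_zero.1 (hsmul _ l hl h1)
      rw [← h3]
      refine Finset.sum_congr rfl fun k _ => ?_
      by_cases hk : e k ∈ I
      · simp [hAI k l hk hl]
      · simp [c', hk]
  have hdet : (A.map (Int.cast : ℤ → 𝕂)).transpose.det ≠ 0 := by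
    rw [Matrix.det_transpose]
    have h4 := Int.cast_det (R := 𝕂) A
    rw [← h4]
    exact_mod_cast H.det_ne
  have hc0 := Matrix.eq_zero_of_mulVec_eq_zero hdet hc'
  rw [← hc]
  refine Finset.sum_eq_zero fun k _ => ?_
  by_cases hk : e k ∈ I
  · have h1 := H.ef k k
    rw [if_pos rfl] at h1
    rw [← hs k, ← h1, LieModuleHom.map_lie, hI _ hk, smul_zero]
  · have h1 := congrFun hc0 k
    simp only [c', hk, if_false, Pi.zero_apply] at h1
    rw [h1, zero_smul]

end Kernel

/-! ### Chevalley–Serre relations in the Kac–Moody algebra. -/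

section Serre

variable (𝕂 : Type*) [Field 𝕂] {ι : Type} [DecidableEq ι] (A : Matrix ι ι ℤ)

/-- The projection from the free Lie algebra. -/
def freeToSerre : FreeLieAlgebra 𝕂 (CartanMatrix.Generators ι) →ₗ⁅𝕂⁆ Matrix.ToLieAlgebra 𝕂 A :=
  { (CartanMatrix.Relations.toIdeal 𝕂 A).toSubmodule.mkQ with map_lie' := rfl }

theorem freeToSerre_eq_zero {x : FreeLieAlgebra 𝕂 (CartanMatrix.Generators ι)}
    (hx : x ∈ CartanMatrix.Relations.toSet 𝕂 A) : freeToSerre 𝕂 A x = 0 := g_rel 𝕂 A hx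

theorem freeToSerre_E (i : ι) :
    freeToSerre 𝕂 A (FreeLieAlgebra.of 𝕂 (CartanMatrix.Generators.E i)) = gE 𝕂 A i := rfl

theorem freeToSerre_F (i : ι) :
    freeToSerre 𝕂 A (FreeLieAlgebra.of 𝕂 (CartanMatrix.Generators.F i)) = gF 𝕂 A i := rfl

theorem freeToSerre_H (i : ι) :
    freeToSerre 𝕂 A (FreeLieAlgebra.of 𝕂 (CartanMatrix.Generators.H i)) = gH 𝕂 A i := rfl

theorem g_hh (i j : ι) : ⁅gH 𝕂 A i, gH 𝕂 A j⁆ = 0 := by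
  have h := freeToSerre_eq_zero 𝕂 A (x := CartanMatrix.Relations.HH 𝕂 (i, j))
    (by simp [CartanMatrix.Relations.toSet])
  simpa only [CartanMatrix.Relations.HH, Function.uncurry, Function.comp, LieHom.map_lie,
    freeToSerre_H] using h

theorem g_ef_ite (i j : ι) : ⁅gE 𝕂 A i, gF 𝕂 A j⁆ = if i = j then gH 𝕂 A i else 0 := by
  split_ifs with hij
  · subst hij
    exact g_ef 𝕂 A i
  · have h := freeToSerre_eq_zero 𝕂 A (x := CartanMatrix.Relations.EF 𝕂 (i, j))
      (by simp [CartanMatrix.Relations.toSet])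
    simpa only [CartanMatrix.Relations.EF, Function.uncurry, Function.comp, if_neg hij,
      LieHom.map_lie, freeToSerre_E, freeToSerre_F] using h

theorem g_he (i j : ι) : ⁅gH 𝕂 A i, gE 𝕂 A j⁆ = (A i j : 𝕂) • gE 𝕂 A j := by
  have h := freeToSerre_eq_zero 𝕂 A (x := CartanMatrix.Relations.HE 𝕂 A (i, j))
    (by simp [CartanMatrix.Relations.toSet])
  simp only [CartanMatrix.Relations.HE, Function.uncurry, Function.comp, map_sub, map_zsmul,
    LieHom.map_lie, freeToSerre_E, freeToSerre_H] at h
  rw [← Int.cast_smul_eq_zsmul 𝕂] at h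
  exact sub_eq_zero.1 h

theorem g_serreE (i j : ι) :
    (LieAlgebra.ad 𝕂 (Matrix.ToLieAlgebra 𝕂 A) (gE 𝕂 A i) ^ ((-A i j).toNat + 1)) (gE 𝕂 A j) =
      0 := by
  have h := freeToSerre_eq_zero 𝕂 A (x := CartanMatrix.Relations.adE 𝕂 A (i, j))
    (by simp [CartanMatrix.Relations.toSet])
  simp only [CartanMatrix.Relations.adE, Function.uncurry, Function.comp, Datum.map_ad_pow,
    LieHom.map_lie, freeToSerre_E] at h
  rwa [pow_succ, Module.End.mul_apply, LieAlgebra.ad_apply]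

theorem g_serreF (i j : ι) :
    (LieAlgebra.ad 𝕂 (Matrix.ToLieAlgebra 𝕂 A) (gF 𝕂 A i) ^ ((-A i j).toNat + 1)) (gF 𝕂 A j) =
      0 := by
  have h := freeToSerre_eq_zero 𝕂 A (x := CartanMatrix.Relations.adF 𝕂 A (i, j))
    (by simp [CartanMatrix.Relations.toSet])
  simp only [CartanMatrix.Relations.adF, Function.uncurry, Function.comp, Datum.map_ad_pow,
    LieHom.map_lie, freeToSerre_F] at h
  rwa [pow_succ, Module.End.mul_apply, LieAlgebra.ad_apply]

end Serre

/-! ### The subalgebra `𝔤⁻` and the elements `f_{0k}`, `e_0` of `W`. -/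

namespace Datum

variable {𝕂 : Type*} [Field 𝕂] {r : ℕ} (D : Datum 𝕂 r)

/-- The Cartan matrix of `𝔤⁻`. -/
abbrev AK : Matrix D.K D.K ℤ := D.A.submatrix Subtype.val Subtype.val

/-- The Chevalley generators `e_k` of `𝔤⁻`. -/
def eMinus (k : D.K) : D.gMinus :=
  ⟨gE 𝕂 D.A k, LieSubalgebra.subset_lieSpan ⟨k, Or.inl rfl⟩⟩

/-- The Chevalley generators `f_k` of `𝔤⁻`. -/
def fMinus (k : D.K) : D.gMinus :=
  ⟨gF 𝕂 D.A k, LieSubalgebra.subset_lieSpan ⟨k, Or.inr (Or.inl rfl)⟩⟩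

theorem isChevalley : IsChevalley 𝕂 D.AK D.eMinus D.fMinus D.hMinus where
  ef i j := by
    apply Subtype.ext
    rw [LieSubalgebra.coe_bracket]
    refine (g_ef_ite 𝕂 D.A i j).trans ?_
    by_cases hij : i = j
    · subst hij; simp [hMinus]
    · simp [hij, Subtype.coe_injective.ne hij]
  he i j := Subtype.ext (g_he 𝕂 D.A i j)
  hf i j := Subtype.ext (g_hf 𝕂 D.A i j)
  hh i j := Subtype.ext (g_hh 𝕂 D.A i j)
  lieSpan_eq := by
    rw [eq_top_iff]
    have h1 : D.gMinus ≤ (LieSubalgebra.lieSpan 𝕂 D.gMinus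
        (Set.range D.eMinus ∪ Set.range D.fMinus)).map D.gMinus.incl := by
      have he : ∀ k, D.eMinus k ∈ LieSubalgebra.lieSpan 𝕂 D.gMinus
          (Set.range D.eMinus ∪ Set.range D.fMinus) := fun k =>
        LieSubalgebra.subset_lieSpan (Or.inl ⟨k, rfl⟩)
      have hf : ∀ k, D.fMinus k ∈ LieSubalgebra.lieSpan 𝕂 D.gMinus
          (Set.range D.eMinus ∪ Set.range D.fMinus) := fun k =>
        LieSubalgebra.subset_lieSpan (Or.inr ⟨k, rfl⟩)
      conv_lhs => rw [gMinus]
      rw [LieSubalgebra.lieSpan_le]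
      rintro x ⟨k, rfl | rfl | rfl⟩
      · exact ⟨_, he k, rfl⟩
      · exact ⟨_, hf k, rfl⟩
      · exact ⟨_, LieSubalgebra.lie_mem _ (he k) (hf k), g_ef 𝕂 D.A k⟩
    intro x _
    obtain ⟨y, hy, hyx⟩ := h1 x.2
    rwa [← Subtype.ext hyx]
  serreE i j := ⟨_, Subtype.ext ((map_ad_pow D.gMinus.incl _ _ _).trans (g_serreE 𝕂 D.A i j))⟩
  serreF i j := ⟨_, Subtype.ext ((map_ad_pow D.gMinus.incl _ _ _).trans (g_serreF 𝕂 D.A i j))⟩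
  diag i := D.A_diag i
  det_ne := D.AK_det

theorem wf0_mem (i : Option D.K) : D.wf0 i ∈ D.wGrade (-1) :=
  ⟨_, of_mem_freeGrade 𝕂 D.genDegree (Gen.f0 i), rfl⟩

theorem we0_mem : D.we none ∈ D.wGrade 1 :=
  ⟨_, of_mem_freeGrade 𝕂 D.genDegree (Gen.e none), rfl⟩

variable [CharZero 𝕂]

theorem eMinus_lie (k : D.K) (w : D.W) : ⁅D.eMinus k, w⁆ = D.wBracket (D.we (some k)) w :=
  congrArg (fun z => D.wBracket z w) (D.gToW_e k)

theorem fMinus_lie (k : D.K) (w : D.W) : ⁅D.fMinus k, w⁆ = D.wBracket (D.wf k) w :=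
  congrArg (fun z => D.wBracket z w) (D.gToW_f k)

theorem hMinus_lie (k : D.K) (w : D.W) : ⁅D.hMinus k, w⁆ = D.wBracket (D.wh (some k)) w :=
  congrArg (fun z => D.wBracket z w) (D.gToW_h k)

/-- These are defining relations of `W`, restricted to indices in `K`; `h_k` acts by zero on the
`f_{0l}` because `B_k0 = -λ_k = 0`. -/
theorem isCartanLike_wf0 :
    IsCartanLike 𝕂 D.AK D.eMinus D.fMinus D.hMinus fun k => D.wf0 (some k) where
  hv i j := by
    have h := D.toW_rel (Rel.hf0 (some i) (some j))
    rw [map_add, toW_mul, map_smul] at h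
    rw [hMinus_lie]
    simp only [extendedCartan, i.2, Nat.cast_zero, neg_zero, zero_smul,
      add_zero] at h
    exact h
  efv k l i := by
    have h := D.toW_rel (Rel.ekfl k l (some i))
    rw [map_sub, toW_mul, toW_mul, sub_eq_zero] at h
    rw [fMinus_lie, eMinus_lie]
    refine h.trans ?_
    split_ifs
    · rw [map_smul]; rfl
    · exact map_zero _
  eev k i := by
    rw [eMinus_lie, eMinus_lie]
    exact D.toW_rel (Rel.ekek k (some i))
  ffv k i := by
    rw [fMinus_lie, fMinus_lie]
    exact D.toW_rel (Rel.fkfk k (some i))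

theorem isCartanLike_neg_wf0 :
    IsCartanLike 𝕂 D.AK D.eMinus D.fMinus D.hMinus fun k => -D.wf0 (some k) where
  hv i j := by rw [lie_neg, D.isCartanLike_wf0.hv, neg_zero]
  efv k l i := by
    rw [lie_neg, lie_neg, D.isCartanLike_wf0.efv]
    split_ifs <;> simp
  eev k i := by rw [lie_neg, lie_neg, D.isCartanLike_wf0.eev, neg_zero]
  ffv k i := by rw [lie_neg, lie_neg, D.isCartanLike_wf0.ffv, neg_zero]

/-- The generator `e_0` is invariant under `𝔤⁻`. -/
theorem lie_we0 (x : D.gMinus) : ⁅x, D.we none⁆ = 0 := by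
  have he : ∀ k : D.K, ⁅D.eMinus k, D.we none⁆ = 0 := by
    intro k
    -- As `λ_k = 0`, the Serre relation between `e_k` and `e_0` has exponent `1`, so the two
    -- commute.
    have hB : D.B (some k) none = -((0 : ℕ) : 𝕂) := by simp [extendedCartan, k.2]
    have h := D.toW_rel (Rel.serreE (some (k : Fin r)) none 0 hB)
    rw [toW_adPow, zero_add, pow_one] at h
    rw [eMinus_lie]
    exact h
  have hf : ∀ k : D.K, ⁅D.fMinus k, D.we none⁆ = 0 := by
    intro k
    have h := D.toW_rel (Rel.ef none (k : Fin r))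
    rw [if_neg (Option.some_ne_none _).symm, sub_zero] at h
    have h' : D.wBracket (D.we none) (D.wf k) = 0 := h
    have hsk := D.wBracket_skew (D.wf_mem k) D.we0_mem
    rw [h', smul_zero, neg_zero] at hsk
    rw [fMinus_lie, hsk]
  have hx : x ∈ LieSubalgebra.lieSpan 𝕂 D.gMinus (Set.range D.eMinus ∪ Set.range D.fMinus) :=
    D.isChevalley.lieSpan_eq ▸ LieSubalgebra.mem_top x
  induction hx using LieSubalgebra.lieSpan_induction with
  | mem x hx =>
    rcases hx with ⟨k, rfl⟩ | ⟨k, rfl⟩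
    · exact he k
    · exact hf k
  | zero => exact zero_lie _
  | add x y _ _ hx hy => rw [add_lie, hx, hy, add_zero]
  | smul a x _ hx => rw [smul_lie, hx, smul_zero]
  | lie x y _ _ hx hy => rw [lie_lie, hx, hy, lie_zero, lie_zero, sub_zero]

end Datum

/-! ### The map `♯`: root formula, uniqueness, image and kernel. -/

namespace Datum

variable {𝕂 : Type*} [Field 𝕂] {r : ℕ} (D : Datum 𝕂 r) [CharZero 𝕂]

theorem form_eq_apply (μ α : D.Weight) : D.form μ α = α (D.φ.symm μ) := by
  rw [form, κCartan_symm]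
  have h1 : D.κCartan (D.φ.symm α) (D.φ.symm μ) = D.φ (D.φ.symm α) (D.φ.symm μ) :=
    (LinearMap.BilinForm.toDual_def D.κCartan_nondegenerate).symm
  rw [h1, LinearEquiv.apply_symm_apply]

theorem coe_eq_sum_repr (y : D.cartan) :
    (y : D.gMinus) = ∑ k, D.cartanBasis.repr y k • D.hMinus k := by
  conv_lhs => rw [← D.cartanBasis.sum_repr y]
  change D.cartan.subtype _ = _
  rw [map_sum]
  refine Finset.sum_congr rfl fun k _ => ?_
  rw [map_smul]
  exact congrArg _ (D.cartanBasis_apply k)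

/-- Since `φ(h_k) = α_k^∨`, the coordinates of `μ` in the basis `(α_k^∨)` are those of `φ⁻¹(μ)` in
the basis `(h_k)`. -/
theorem map_symm_φ_eq_neg_f0vee {s : D.gMinus →ₗ[𝕂] D.W}
    (hs : ∀ k, s (D.hMinus k) = -D.wf0 (some k)) (μ : D.Weight) :
    s (D.φ.symm μ : D.cartan) = -D.f0vee μ := by
  rw [coe_eq_sum_repr, map_sum, f0vee, ← Finset.sum_neg_distrib]
  refine Finset.sum_congr rfl fun k _ => ?_
  rw [map_smul, hs, smul_neg]
  rfl

/-- With `f_{0μ^∨} = -s(φ⁻¹ μ)`, equivariance gives `[x, f_{0μ^∨}] = s [φ⁻¹ μ, x] = (μ, α) s x` for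
`x` of root `α`. -/
theorem isSharp_of_lieModuleHom (s : D.gMinus →ₗ⁅𝕂, D.gMinus⁆ D.W)
    (hs : ∀ k, s (D.hMinus k) = -D.wf0 (some k)) : D.IsSharp (s : D.gMinus →ₗ[𝕂] D.W) where
  root α _ x hx μ hμ := by
    have h1 : D.f0vee μ = -s (D.φ.symm μ : D.cartan) := by
      have := D.map_symm_φ_eq_neg_f0vee (s := (s : D.gMinus →ₗ[𝕂] D.W)) hs μ
      rw [eq_neg_iff_add_eq_zero, add_comm, ← eq_neg_iff_add_eq_zero]
      exact this
    rw [h1, lie_neg, ← LieModuleHom.map_lie, ← map_neg, lie_skew, hx, form_eq_apply] at *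
    rw [map_smul, smul_smul, inv_mul_cancel₀ hμ, one_smul]
    rfl
  cartan := hs

/-- The weight `∑ k, c k • α k`. -/
def rootCombination (c : D.K → ℤ) : D.Weight := ∑ k, (c k : 𝕂) • D.simpleRoot k

theorem rootCombination_apply (c : D.K → ℤ) (l : D.K) :
    D.rootCombination c (D.cartanBasis l) = ((D.AK.mulVec c l : ℤ) : 𝕂) := by
  simp [rootCombination, LinearMap.sum_apply, simpleRoot_apply, Matrix.mulVec, dotProduct, mul_comm]

theorem rootCombination_ne_zero {c : D.K → ℤ} (hc : c ≠ 0) : D.rootCombination c ≠ 0 := by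
  intro h0
  refine hc (D.isChevalley.mulVec_injective (funext fun l => ?_))
  have h1 := D.rootCombination_apply c l
  rw [h0, LinearMap.zero_apply] at h1
  rw [Matrix.mulVec_zero, Pi.zero_apply]
  exact_mod_cast h1.symm

theorem mem_rootSpace_of_mem_weightSubmodule {c : D.K → ℤ} {x : D.gMinus}
    (hx : x ∈ weightSubmodule 𝕂 D.gMinus D.AK D.hMinus c) :
    x ∈ D.rootSpace (D.rootCombination c) := by
  intro y
  rw [coe_eq_sum_repr, sum_lie]
  conv_rhs => rw [← D.cartanBasis.sum_repr y]
  rw [map_sum, Finset.sum_smul]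
  refine Finset.sum_congr rfl fun k _ => ?_
  rw [smul_lie, hx k, map_smul, rootCombination_apply, smul_eq_mul, smul_smul]

/-- Weight vectors of nonzero weight and the `h_k` span `𝔤⁻`. For a root `α` choose `y` with `α(y) ≠
0`; then `μ = φ(y)` satisfies `(μ, α) ≠ 0`, and the root formula fixes the value. -/
theorem IsSharp.eq {s t : D.gMinus →ₗ[𝕂] D.W} (hs : D.IsSharp s) (ht : D.IsSharp t) : s = t := by
  have hroot : ∀ (c : D.K → ℤ), c ≠ 0 → ∀ x ∈ weightSubmodule 𝕂 D.gMinus D.AK D.hMinus c,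
      s x = t x := by
    intro c hc x hx
    by_cases hx0 : x = 0
    · rw [hx0, map_zero, map_zero]
    have hmem := D.mem_rootSpace_of_mem_weightSubmodule hx
    have hα := D.rootCombination_ne_zero hc
    have hR : D.IsRoot (D.rootCombination c) :=
      ⟨hα, fun h => hx0 (by rw [h] at hmem; exact (Submodule.mem_bot 𝕂).1 hmem)⟩
    obtain ⟨y, hy⟩ : ∃ y, D.rootCombination c y ≠ 0 := by
      by_contra! h
      exact hα (LinearMap.ext h)
    have hμ : D.form (D.φ y) (D.rootCombination c) ≠ 0 := by
      rwa [form_eq_apply, LinearEquiv.symm_apply_apply]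
    rw [hs.root _ hR x hmem _ hμ, ht.root _ hR x hmem _ hμ]
  refine LinearMap.ext_on_range D.isChevalley.span_spanningVector_eq_top ?_
  have hmem := D.isChevalley.isCartanLike.spanningVector_mem D.isChevalley
  rintro (p | k | p)
  · refine hroot _ ?_ _ (hmem (Sum.inl p))
    intro h0
    have := monomialWeight_self_pos p.1 p.2
    rw [show monomialWeight p.1 p.2 = 0 from h0] at this
    exact lt_irrefl _ this
  · exact (hs.cartan k).trans (ht.cartan k).symm
  · refine hroot _ ?_ _ (hmem (Sum.inr (Sum.inr p)))
    intro h0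
    have := monomialWeight_self_pos p.1 p.2
    rw [neg_eq_zero.1 (show -monomialWeight p.1 p.2 = 0 from h0)] at this
    exact lt_irrefl _ this

theorem mem_wGrade_of_mem_f0Module {w : D.W} (hw : w ∈ D.f0Module) : w ∈ D.wGrade (-1) := by
  induction hw using LieSubmodule.lieSpan_induction with
  | mem w hw =>
    obtain ⟨k, rfl⟩ := hw
    exact D.wf0_mem _
  | zero => exact zero_mem _
  | add x y _ _ hx hy => exact add_mem hx hy
  | smul a x _ hx => exact Submodule.smul_mem _ _ hx
  | lie x y _ hy =>
    have := D.wBracket_mem (D.gToW_mem (x : D.g)) hy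
    rwa [zero_add] at this

theorem range_eq_f0Module (s : D.gMinus →ₗ⁅𝕂, D.gMinus⁆ D.W)
    (hs : ∀ k, s (D.hMinus k) = -D.wf0 (some k)) : s.range = D.f0Module := by
  apply le_antisymm
  · have hle : LieSubmodule.lieSpan 𝕂 D.gMinus (Set.range D.hMinus) ≤ D.f0Module.comap s := by
      rw [LieSubmodule.lieSpan_le]
      rintro _ ⟨k, rfl⟩
      change s (D.hMinus k) ∈ D.f0Module
      rw [hs]
      exact neg_mem (LieSubmodule.subset_lieSpan ⟨k, rfl⟩)
    rw [D.isChevalley.lieSpan_h_eq_top] at hle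
    rintro _ ⟨x, rfl⟩
    exact hle (LieSubmodule.mem_top x)
  · rw [f0Module, LieSubmodule.lieSpan_le]
    rintro _ ⟨k, rfl⟩
    exact ⟨-D.hMinus k, by
      rw [map_neg, hs, neg_neg]⟩

/-- Bracketing with `e_0` inverts the map `♯` up to sign. -/
theorem wBracket_we0_sharp (s : D.gMinus →ₗ⁅𝕂, D.gMinus⁆ D.W)
    (hs : ∀ k, s (D.hMinus k) = -D.wf0 (some k)) (x : D.gMinus) :
    D.wBracket (D.we none) (s x) = -D.gMinusToW x := by
  -- By invariance of `e_0` the Jacobi identity loses one term, and no sign appears because `x` is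
  -- even.
  have hcomm : ∀ (x : D.gMinus) (w : D.W),
      D.wBracket (D.we none) ⁅x, w⁆ = ⁅x, D.wBracket (D.we none) w⁆ := by
    intro x w
    have h1 := D.wBracket_jacobi (D.gToW_mem (x : D.g)) D.we0_mem w
    have h2 : D.wBracket (D.gToW (x : D.g)) (D.we none) = 0 := D.lie_we0 x
    rw [h2, map_zero, LinearMap.zero_apply, zero_add, zero_mul, Int.negOnePow_zero, one_smul] at h1
    exact h1.symm
  let p : D.gMinus →ₗ⁅𝕂, D.gMinus⁆ D.W :=
    { D.wBracket (D.we none) ∘ₗ (s : D.gMinus →ₗ[𝕂] D.W) with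
      map_lie' := fun {x y} => by
        change D.wBracket (D.we none) (s ⁅x, y⁆) = ⁅x, D.wBracket (D.we none) (s y)⁆
        rw [LieModuleHom.map_lie, hcomm] }
  have h1 : p = -D.gMinusToW := by
    refine lieHom_ext_of_lieSpan_eq_top D.isChevalley.lieSpan_h_eq_top ?_
    rintro _ ⟨k, rfl⟩
    change D.wBracket (D.we none) (s (D.hMinus k)) = -D.gToW (gH 𝕂 D.A k)
    rw [hs, map_neg, gToW_h]
    have h := D.toW_rel (Rel.e0f0 (some k))
    rw [map_sub, toW_mul, sub_eq_zero] at h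
    exact congrArg Neg.neg h
  exact congrArg (fun q : D.gMinus →ₗ⁅𝕂, D.gMinus⁆ D.W => q x) h1

theorem ker_sharp (s : D.gMinus →ₗ⁅𝕂, D.gMinus⁆ D.W)
    (hs : ∀ k, s (D.hMinus k) = -D.wf0 (some k)) (x : D.gMinus) :
    s x = 0 ↔ D.gMinusToW x = 0 := by
  have h1 : ∀ x, s x = 0 → D.gMinusToW x = 0 := by
    intro x hx
    have h := D.wBracket_we0_sharp s hs x
    rw [hx, map_zero, eq_comm, neg_eq_zero] at h
    exact h
  refine ⟨h1 x, fun hx => ?_⟩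
  -- The ideal is the kernel of `𝔤⁻ → W`: it acts trivially on `W` since the action factors through
  -- this map, and it contains the kernel of `s` by `h1`.
  refine D.isCartanLike_neg_wf0.ideal_le_ker D.isChevalley (fun i j => D.A_zero i j) s hs
    D.gMinusToW.ker ?_ (fun y hy => LieModuleHom.mem_ker.2 (h1 y hy)) x
    (LieModuleHom.mem_ker.2 hx)
  intro y hy m
  change D.wBracket (D.gMinusToW y) m = 0
  rw [LieModuleHom.mem_ker.1 hy, map_zero, LinearMap.zero_apply]

end Datum

/-- Two module homomorphisms with the same kernel have isomorphic images. -/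
theorem exists_range_equiv {𝕂 L M M' : Type*} [Field 𝕂] [LieRing L] [LieAlgebra 𝕂 L]
    [AddCommGroup M] [Module 𝕂 M] [LieRingModule L M] [LieModule 𝕂 L M]
    [AddCommGroup M'] [Module 𝕂 M'] [LieRingModule L M'] [LieModule 𝕂 L M']
    (p q : M →ₗ⁅𝕂, L⁆ M') (h : ∀ x, q x = 0 ↔ p x = 0) :
    Nonempty (p.range ≃ₗ⁅𝕂, L⁆ q.range) := by
  have hker : LinearMap.ker (p : M →ₗ[𝕂] M') = LinearMap.ker (q : M →ₗ[𝕂] M') :=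
    Submodule.ext fun x => (h x).symm
  let E : LinearMap.range (p : M →ₗ[𝕂] M') ≃ₗ[𝕂] LinearMap.range (q : M →ₗ[𝕂] M') :=
    (p : M →ₗ[𝕂] M').quotKerEquivRange.symm ≪≫ₗ Submodule.quotEquivOfEq _ _ hker ≪≫ₗ
      (q : M →ₗ[𝕂] M').quotKerEquivRange
  have hE : ∀ x, E ⟨p x, ⟨x, rfl⟩⟩ = ⟨q x, ⟨x, rfl⟩⟩ := by
    intro x
    have h1 : (p : M →ₗ[𝕂] M').quotKerEquivRange.symm ⟨p x, ⟨x, rfl⟩⟩ = Submodule.Quotient.mk x := by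
      rw [LinearEquiv.symm_apply_eq]
      rfl
    simp only [E, LinearEquiv.trans_apply, h1, Submodule.quotEquivOfEq_mk]
    rfl
  have hlie : ∀ (x : L) (y : M), ∀ z : p.range, (z : M') = p y → ∀ w : p.range, (w : M') = p ⁅x, y⁆ →
      (E w : M') = ⁅x, (E z : M')⁆ := by
    rintro x y ⟨z, hz⟩ rfl ⟨w, hw⟩ rfl
    have h1 := congrArg Subtype.val (hE y)
    have h2 := congrArg Subtype.val (hE ⁅x, y⁆)
    exact h2.trans ((LieModuleHom.map_lie q x y).trans (congrArg (fun m => ⁅x, m⁆) h1.symm))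
  exact ⟨{ E with
    map_lie' := fun {x z} => by
      obtain ⟨_, ⟨y, rfl⟩⟩ := z
      exact Subtype.ext (hlie x y _ rfl _ (LieModuleHom.map_lie p x y).symm) }⟩

end THA

end

theorem proposition2p5 {𝕂 : Type*} [Field 𝕂] [IsAlgClosed 𝕂] [CharZero 𝕂] {r : ℕ}
    (D : THA.Datum 𝕂 r) (hfin : FiniteDimensional 𝕂 D.gMinus) :
    (∃! s : D.gMinus →ₗ[𝕂] D.W, D.IsSharp s) ∧
    ∀ s : D.gMinus →ₗ[𝕂] D.W, D.IsSharp s →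
      (∀ x, s x ∈ D.wGrade (-1)) ∧
      (∀ x y : D.gMinus, ⁅x, s y⁆ = s ⁅x, y⁆) ∧
      LinearMap.range s = D.f0Module.toSubmodule ∧
      LinearMap.ker s = LinearMap.ker (D.gMinusToW : D.gMinus →ₗ[𝕂] D.W) ∧
      Nonempty (D.gMinusToW.range ≃ₗ⁅𝕂, D.gMinus⁆ D.f0Module) ∧
      (Function.Injective D.gMinusToW →
        ∃ E : D.gMinus ≃ₗ⁅𝕂, D.gMinus⁆ D.f0Module, ∀ x, (E x : D.W) = s x) := by
  obtain ⟨s, hs⟩ := D.isCartanLike_neg_wf0.exists_lieModuleHom D.isChevalley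
    D.hMinus_linearIndependent
  have hsharp := D.isSharp_of_lieModuleHom s hs
  have hrange := D.range_eq_f0Module s hs
  have hmem : ∀ x, s x ∈ D.f0Module := fun x => hrange ▸ ⟨x, rfl⟩
  refine ⟨⟨s, hsharp, fun t ht => ht.eq D hsharp⟩, fun t ht => ?_⟩
  -- By uniqueness, every claim need only be checked for the homomorphism constructed above.
  obtain rfl := ht.eq D hsharp
  refine ⟨fun x => D.mem_wGrade_of_mem_f0Module (hmem x), fun x y => (s.map_lie x y).symm, ?_,
    Submodule.ext (D.ker_sharp s hs), ?_, fun hinj => ?_⟩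
  · rw [← hrange]
    rfl
  · rw [← hrange]
    exact THA.exists_range_equiv _ _ (D.ker_sharp s hs)
  · let t : D.gMinus →ₗ[𝕂] D.f0Module :=
      (s : D.gMinus →ₗ[𝕂] D.W).codRestrict D.f0Module.toSubmodule hmem
    have ht : Function.Bijective t := by
      constructor
      · rw [injective_iff_map_eq_zero]
        intro x hx
        have h1 : s x = 0 := congrArg Subtype.val hx
        exact (injective_iff_map_eq_zero _).1 hinj x ((D.ker_sharp s hs x).1 h1)
      · rintro ⟨y, hy⟩
        rw [← hrange] at hy
        obtain ⟨x, rfl⟩ := hy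
        exact ⟨x, rfl⟩
    exact ⟨{ LinearEquiv.ofBijective t ht with
      map_lie' := fun {x y} => Subtype.ext (s.map_lie x y) }, fun x => rfl⟩
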